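/- For a frame $U=(u_1,\dots,u_n)$ of vectors in $\mathbb{R}^d$, let $s(U)=\sum_{i=1}^n\|u_i\|_2^2$. For $\epsilon\ge 0$, $U$ is called $\epsilon$-nearly doubly balanced if, in the Loewner order, $$(1-\epsilon)\tfrac{s(U)}{d}I_d\preceq\sum_{i=1}^n u_iu_i^{*}\preceq(1+\epsilon)\tfrac{s(U)}{d}I_d\quad\text{and}\quad(1-\epsilon)\tfrac{s(U)}{n}I_n\preceq\operatorname{diag}\big(\|u_1\|_2^2,\dots,\|u_n\|_2^2\big)\preceq(1+\epsilon)\tfrac{s(U)}{n}I_n .$$ $U$ satisfies the $\lambda$-spectral gap condition if $\lambda_2(G)\le(1-\lambda)^2\,\frac{s(U)^2}{dn}$, where $G\in\mathbb{R}^{n\times n}$ has entries $G_{ij}=\langle u_i,u_j\rangle^2$ and $\lambda_2(G)$ is its second largest eigenvalue, counted with multiplicity (and $0$ if $n=1$). If all $u_i$ are unit vectors, then $s(U)=n$ and the condition reads $\lambda_2(G)\le(1-\lambda)^2\,n/d$. **Theorem.** Let $u_1,\dots,u_n$ be independent, uniformly distributed random unit vectors in $\mathbb{R}^d$, and let $U=(u_1,\dots,u_n)$.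 (i) There is a sequence $\epsilon_d\ge 0$ with $\epsilon_d=o(1/\log d)$, that is $\epsilon_d\log d\to 0$ as $d\to\infty$, such that for every constant $\lambda\in[0,1)$ there are constants $C>0$ and $D$, depending only on $\lambda$, for which the following holds: for all $d\ge D$ and all $n\ge C\,d^{4/3}$, with probability at least $0.99$, the frame $U$ is $\epsilon_d$-nearly doubly balanced and $\lambda_2(G)\le(1-\lambda)^2\,n/d$. (ii) There is an absolute constant $\lambda\in(0,1)$ such that for every $c>0$ there is a constant $C>0$, depending only on $c$, for which the following holds: for all $d\ge 1$ and all $n\ge C\,d^{4/3}$ there is $\epsilon\ge 0$ with $\epsilon\log d\le c$ such that, with probability at least $0.99$, the frame $U$ is $\epsilon$-nearly doubly balanced and $\lambda_2(G)\le(1-\lambda)^2\,n/d$. -/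

import Mathlib

open MeasureTheory Filter Topology

/-- The size `s(U) = ∑ ‖u_i‖²` of a frame `U = (u_1, …, u_n)` in `ℝ^d`. -/
noncomputable def frameSize {d n : ℕ} (u : Fin n → EuclideanSpace ℝ (Fin d)) : ℝ :=
  ∑ i, ‖u i‖ ^ 2

/-- The frame matrix `∑ u_i u_iᵀ`. -/
noncomputable def frameMatrix {d n : ℕ} (u : Fin n → EuclideanSpace ℝ (Fin d)) :
    Matrix (Fin d) (Fin d) ℝ :=
  ∑ i, Matrix.vecMulVec (fun a => u i a) (fun a => u i a)

/-- The diagonal matrix of the squared norms of the vectors of a frame. -/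
noncomputable def frameNormMatrix {d n : ℕ} (u : Fin n → EuclideanSpace ℝ (Fin d)) :
    Matrix (Fin n) (Fin n) ℝ :=
  Matrix.diagonal (fun i => ‖u i‖ ^ 2)

/-- `ε`-nearly doubly balanced frames:
`(1-ε) s/d I_d ≼ ∑ u_i u_iᵀ ≼ (1+ε) s/d I_d` and
`(1-ε) s/n I_n ≼ diag(‖u_i‖²) ≼ (1+ε) s/n I_n` in the Loewner order. -/
def NearlyDoublyBalanced {d n : ℕ} (ε : ℝ) (u : Fin n → EuclideanSpace ℝ (Fin d)) : Prop :=
  (frameMatrix u - ((1 - ε) * (frameSize u / d)) • (1 : Matrix (Fin d) (Fin d) ℝ)).PosSemidef ∧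
  (((1 + ε) * (frameSize u / d)) • (1 : Matrix (Fin d) (Fin d) ℝ) - frameMatrix u).PosSemidef ∧
  (frameNormMatrix u
    - ((1 - ε) * (frameSize u / n)) • (1 : Matrix (Fin n) (Fin n) ℝ)).PosSemidef ∧
  (((1 + ε) * (frameSize u / n)) • (1 : Matrix (Fin n) (Fin n) ℝ)
    - frameNormMatrix u).PosSemidef

/-- The entrywise squared Gram matrix `G_ij = ⟨u_i, u_j⟩²`. -/
noncomputable def sqGram {d n : ℕ} (u : Fin n → EuclideanSpace ℝ (Fin d)) :
    Matrix (Fin n) (Fin n) ℝ :=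
  Matrix.of fun i j => inner ℝ (u i) (u j) ^ 2

theorem sqGram_isHermitian {d n : ℕ} (u : Fin n → EuclideanSpace ℝ (Fin d)) :
    (sqGram u).IsHermitian := by
  ext i j
  simp [sqGram, real_inner_comm]

/-- The second largest eigenvalue, with multiplicity, of a Hermitian matrix (`eigenvalues₀` lists
the eigenvalues in decreasing order). A matrix of size below two has none; the value is then `0`. -/
noncomputable def secondEigenvalue {n : ℕ} {A : Matrix (Fin n) (Fin n) ℝ}
    (hA : A.IsHermitian) : ℝ :=
  if h : 1 < n then hA.eigenvalues₀ ⟨1, by simpa using h⟩ else 0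

/-- The `lam`-spectral gap condition for frames: `λ₂(G) ≤ (1 - lam)² s² / (d n)`. -/
def HasFrameSpectralGap {d n : ℕ} (lam : ℝ) (u : Fin n → EuclideanSpace ℝ (Fin d)) : Prop :=
  secondEigenvalue (sqGram_isHermitian u) ≤ (1 - lam) ^ 2 * (frameSize u ^ 2 / (d * n))

/-- The uniform probability measure on the unit sphere of `ℝ^d` (for `d ≥ 1`): the surface
measure divided by its total mass. -/
noncomputable def sphereUniform (d : ℕ) :
    Measure (Metric.sphere (0 : EuclideanSpace ℝ (Fin d)) 1) :=
  ((volume : Measure (EuclideanSpace ℝ (Fin d))).toSphere Set.univ)⁻¹ •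
    (volume : Measure (EuclideanSpace ℝ (Fin d))).toSphere

/-- The law of `n` independent uniformly random unit vectors in `ℝ^d`. -/
noncomputable def randomUnitVectors (d n : ℕ) :
    Measure (Fin n → Metric.sphere (0 : EuclideanSpace ℝ (Fin d)) 1) :=
  Measure.pi fun _ => sphereUniform d

/-- The event that a tuple of unit vectors, as a frame in `ℝ^d`, is `ε`-nearly doubly balanced
and satisfies the `lam`-spectral gap condition. -/
def goodFrames (d n : ℕ) (ε lam : ℝ) :
    Set (Fin n → Metric.sphere (0 : EuclideanSpace ℝ (Fin d)) 1) :=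
  {u | NearlyDoublyBalanced ε (fun i => (u i : EuclideanSpace ℝ (Fin d))) ∧
    HasFrameSpectralGap lam (fun i => (u i : EuclideanSpace ℝ (Fin d)))}

open scoped Pointwise

/-! The two requirements are proved separately, each failing with probability at most 1/200; only
the balance parameter uses the exponent 4/3.

Balance. Unit vectors make the norm condition trivial, and the matrix condition says that the
quadratic form `frameDeviation` is at most `n * ε` on the sphere. For a fixed direction this form is
a sum of independent centered terms whose exponential moments come from an exact spherical integral
(`sphereUniform_integral_exp_inner_sq_le`), so Chernoff gives a tail `2 exp(-n x² / 8)`. Uniformity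
over directions needs no net: near a maximizer the form keeps half its size on a cap of measure at
least `16⁻ᵈ`, so Fubini and Markov cost only a factor `16ᵈ`. Hence `n x² ≥ 80 d` suffices. With `x`
of order `d^(-1/6)` and `n ≥ C d^(4/3)` this holds, and `d^(-1/6) log d` tends to 0.

Spectral gap. Write `G = K + (1 - 1/d) I + (1/d) J`, with `J` the all-ones matrix and `K` the
off-diagonal part of the kernel `⟨x, y⟩² - 1/d`. On sum-zero vectors `J` vanishes, so it is enough
to bound `K` from above. The kernel composed with itself is `α = 2/(d(d+2))` times itself, so `K²`
should be close to `(n - 2) α K`. The squared Frobenius norm of the difference has mean at most `n²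
α + 2 n³ α²`, which is small against `(n/d)⁴` once `n ≥ C d` with `C` large. A symmetric matrix with
`K² ≈ cK` has top eigenvalue at most about `c`, whence `λ₂(G) ≤ 1 + nα + q` with `q` a small
multiple of `n/d`. -/

/-! ### Spherical integrals: linear maps, symmetry, second and fourth moments. -/

/-- Compute the volume of `A⁻¹(ball)` twice: by the determinant, and in polar coordinates, where the
ray in direction `u` stays inside up to radius `1 / ‖A u‖`. -/
theorem toSphere_lintegral_norm_pow_inv {E : Type*} [NormedAddCommGroup E] [NormedSpace ℝ E]
    [FiniteDimensional ℝ E] [MeasurableSpace E] [BorelSpace E] [Nontrivial E]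
    (μ : Measure E) [μ.IsAddHaarMeasure] (A : E →ₗ[ℝ] E) (hA : LinearMap.det A ≠ 0) :
    ∫⁻ u : Metric.sphere (0 : E) 1, ENNReal.ofReal ((‖A u‖ ^ Module.finrank ℝ E)⁻¹) ∂μ.toSphere =
      ENNReal.ofReal |(LinearMap.det A)⁻¹| * μ.toSphere Set.univ := by
  have hAc : Continuous A := A.continuous_of_finiteDimensional
  have hd : 0 < Module.finrank ℝ E := Module.finrank_pos
  have hinj : Function.Injective A := by
    have := LinearMap.isUnit_iff_isUnit_det A
    have h2 := (LinearMap.isUnit_iff_ker_eq_bot A).1 (this.2 hA.isUnit)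
    exact LinearMap.ker_eq_bot.1 h2
  have hpos : ∀ u : Metric.sphere (0 : E) 1, 0 < ‖A u‖ := fun u => by
    rw [norm_pos_iff]
    intro h
    have : (u : E) = 0 := hinj (by simpa using h)
    exact ne_zero_of_mem_unit_sphere u this
  set s : Set E := A ⁻¹' Metric.ball 0 1 with hs
  have h1 : μ s = ENNReal.ofReal |(LinearMap.det A)⁻¹| * μ (Metric.ball 0 1) :=
    Measure.addHaar_preimage_linearMap μ hA _
  have h2 : μ s = (μ.comap (Subtype.val : ({0}ᶜ : Set E) → E)) (Subtype.val ⁻¹' s) := by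
    rw [comap_subtype_coe_apply (measurableSet_singleton _).compl, Subtype.image_preimage_coe,
      Set.inter_comm, ← Set.sdiff_eq, measure_sdiff_null (measure_singleton _)]
  have h3 : μ s = (μ.toSphere.prod (Measure.volumeIoiPow (Module.finrank ℝ E - 1)))
      {p | (p.2 : ℝ) * ‖A p.1‖ < 1} := by
    rw [h2, ← (μ.measurePreserving_homeomorphUnitSphereProd).measure_preimage_emb
      (Homeomorph.measurableEmbedding _)]
    congr 1
    ext x
    have hx : 0 < ‖(x : E)‖ := norm_pos_iff.2 x.2
    simp only [hs, Set.mem_preimage, mem_ball_zero_iff, Set.mem_ofPred_eq,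
      homeomorphUnitSphereProd_apply_snd_coe, homeomorphUnitSphereProd_apply_fst_coe, map_smul,
      norm_smul, norm_inv, norm_norm]
    rw [mul_inv_cancel_left₀ hx.ne']
  have hmeas : MeasurableSet {p : Metric.sphere (0 : E) 1 × Set.Ioi (0 : ℝ) |
      (p.2 : ℝ) * ‖A p.1‖ < 1} := by
    apply measurableSet_lt <;> fun_prop
  rw [h3, Measure.prod_apply hmeas] at h1
  have h4 : ∀ u : Metric.sphere (0 : E) 1,
      (Measure.volumeIoiPow (Module.finrank ℝ E - 1))
        (Prod.mk u ⁻¹' {p | (p.2 : ℝ) * ‖A p.1‖ < 1}) =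
      ENNReal.ofReal ((‖A u‖ ^ Module.finrank ℝ E)⁻¹) * (Module.finrank ℝ E : ENNReal)⁻¹ := by
    intro u
    have : (Prod.mk u ⁻¹' {p : Metric.sphere (0 : E) 1 × Set.Ioi (0 : ℝ) |
        (p.2 : ℝ) * ‖A p.1‖ < 1}) = Set.Iio ⟨‖A u‖⁻¹, by simpa using hpos u⟩ := by
      ext r
      simp only [Set.mem_preimage, Set.mem_ofPred_eq, Set.mem_Iio, ← Subtype.coe_lt_coe]
      rw [← one_div, lt_div_iff₀ (hpos u)]
    rw [this, Measure.volumeIoiPow_apply_Iio, Nat.sub_add_cancel hd, Nat.cast_pred hd,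
      sub_add_cancel, div_eq_mul_inv, ENNReal.ofReal_mul (by positivity), inv_pow,
      ENNReal.ofReal_inv_of_pos (pow_pos (hpos u) _),
      ENNReal.ofReal_inv_of_pos (Nat.cast_pos.2 hd), ENNReal.ofReal_natCast]
  simp_rw [h4] at h1
  rw [lintegral_mul_const _ (by fun_prop)] at h1
  rw [μ.toSphere_apply_univ, mul_left_comm, ← h1, mul_comm, mul_assoc,
    ENNReal.inv_mul_cancel (by simpa using hd.ne') (by simp), mul_one]

theorem measurePreserving_toSphere {E : Type*} [NormedAddCommGroup E] [InnerProductSpace ℝ E]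
    [FiniteDimensional ℝ E] [MeasurableSpace E] [BorelSpace E]
    (O : E ≃ₗᵢ[ℝ] E) :
    MeasurePreserving (fun u : Metric.sphere (0 : E) 1 =>
      (⟨O u, by simp⟩ : Metric.sphere (0 : E) 1))
      (volume : Measure E).toSphere (volume : Measure E).toSphere := by
  have hm : Measurable (fun u : Metric.sphere (0 : E) 1 =>
      (⟨O u, by simp⟩ : Metric.sphere (0 : E) 1)) := by
    have := O.continuous
    apply Continuous.measurable
    fun_prop
  refine ⟨hm, ?_⟩
  ext s hs
  rw [Measure.map_apply hm hs, Measure.toSphere_apply' _ hs, Measure.toSphere_apply' _ (hm hs)]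
  congr 1
  have hpre : O ⁻¹' (Set.Ioo (0 : ℝ) 1 • ((↑) '' s : Set E)) =
      Set.Ioo (0 : ℝ) 1 • ((↑) '' ((fun u : Metric.sphere (0 : E) 1 =>
        (⟨O u, by simp⟩ : Metric.sphere (0 : E) 1)) ⁻¹' s) : Set E) := by
    ext x
    simp only [Set.mem_preimage, Set.mem_smul, Set.mem_image]
    constructor
    · rintro ⟨r, hr, _, ⟨y, hy, rfl⟩, hxy⟩
      refine ⟨r, hr, O.symm y, ⟨⟨O.symm y, by simp⟩, by simpa using hy, rfl⟩, ?_⟩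
      rw [← O.symm_apply_apply x, ← hxy, map_smul]
    · rintro ⟨r, hr, _, ⟨y, hy, rfl⟩, rfl⟩
      exact ⟨r, hr, O y, ⟨⟨O y, by simp⟩, hy, rfl⟩, by simp⟩
  rw [← hpre]
  exact O.measurePreserving.measure_preimage_emb O.toHomeomorph.measurableEmbedding _

/-- The unit sphere of `ℝ^d`. -/
abbrev UnitSphere (d : ℕ) := Metric.sphere (0 : EuclideanSpace ℝ (Fin d)) 1

theorem sphereUniform_isProbabilityMeasure {d : ℕ} (hd : 1 ≤ d) :
    IsProbabilityMeasure (sphereUniform d) := by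
  have : Nonempty (Fin d) := ⟨⟨0, hd⟩⟩
  refine ⟨?_⟩
  rw [sphereUniform, Measure.smul_apply, smul_eq_mul]
  exact ENNReal.inv_mul_cancel
    (Measure.measure_univ_ne_zero.2 (Measure.toSphere_ne_zero _)) (measure_ne_top _ _)

theorem integrable_of_continuous {X : Type*} [TopologicalSpace X] [CompactSpace X]
    [MeasurableSpace X] [OpensMeasurableSpace X] (μ : Measure X)
    [IsFiniteMeasure μ] {f : X → ℝ} (hf : Continuous f) : Integrable f μ :=
  hf.integrable_of_hasCompactSupport (HasCompactSupport.of_compactSpace f)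

theorem sphereUniform_integral_comp {d : ℕ}
    (O : EuclideanSpace ℝ (Fin d) ≃ₗᵢ[ℝ] EuclideanSpace ℝ (Fin d))
    (f : EuclideanSpace ℝ (Fin d) → ℝ) :
    ∫ u : UnitSphere d, f (O u) ∂sphereUniform d = ∫ u : UnitSphere d, f u ∂sphereUniform d := by
  have hm := (measurePreserving_toSphere O).smul_measure
    (((volume : Measure (EuclideanSpace ℝ (Fin d))).toSphere Set.univ)⁻¹)
  have he : MeasurableEmbedding (fun u : UnitSphere d => (⟨O u, by simp⟩ : UnitSphere d)) := by
    have hc : Continuous (fun u : UnitSphere d => (⟨O u, by simp⟩ : UnitSphere d)) := by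
      have := O.continuous
      fun_prop
    exact hc.measurableEmbedding fun x y hxy => Subtype.ext (O.injective (congrArg Subtype.val hxy))
  exact hm.integral_comp he (fun u => f u)

/-- The reflection in the hyperplane orthogonal to `x - y` exchanges `x` and `y` and preserves the
measure. -/
theorem sphereUniform_integral_inner_eq {d : ℕ} (f : ℝ → ℝ) {x y : EuclideanSpace ℝ (Fin d)}
    (h : ‖x‖ = ‖y‖) :
    ∫ u : UnitSphere d, f (inner ℝ (u : EuclideanSpace ℝ (Fin d)) x) ∂sphereUniform d =
      ∫ u : UnitSphere d, f (inner ℝ (u : EuclideanSpace ℝ (Fin d)) y) ∂sphereUniform d := by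
  have h1 := sphereUniform_integral_comp (Submodule.reflection (ℝ ∙ (x - y))ᗮ)
    (fun u => f (inner ℝ u y))
  have h2 : ∀ u, inner ℝ (Submodule.reflection (ℝ ∙ (x - y))ᗮ u) y = inner ℝ u x := fun u => by
    rw [← LinearIsometryEquiv.inner_map_map (Submodule.reflection (ℝ ∙ (x - y))ᗮ) u x,
      Submodule.reflection_sub h]
  simpa only [h2] using h1

theorem sphereUniform_integral_inner_pow {d : ℕ} (hd : 1 ≤ d) (p : ℕ) :
    ∃ c : ℝ, ∀ x : EuclideanSpace ℝ (Fin d),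
      ∫ u : UnitSphere d, inner ℝ (u : EuclideanSpace ℝ (Fin d)) x ^ p ∂sphereUniform d =
        c * ‖x‖ ^ p := by
  set e : EuclideanSpace ℝ (Fin d) := EuclideanSpace.single ⟨0, hd⟩ 1
  have he : ‖e‖ = 1 := by simp [e]
  refine ⟨∫ u : UnitSphere d, inner ℝ (u : EuclideanSpace ℝ (Fin d)) e ^ p ∂sphereUniform d,
    fun x => ?_⟩
  rw [sphereUniform_integral_inner_eq (fun t => t ^ p) (x := x) (y := ‖x‖ • e)
    (by simp [norm_smul, he]), ← integral_mul_const]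
  simp only [inner_smul_right, mul_pow, mul_comm]

theorem sphereUniform_integral_inner_sq {d : ℕ} (hd : 1 ≤ d) (x : EuclideanSpace ℝ (Fin d)) :
    ∫ u : UnitSphere d, inner ℝ (u : EuclideanSpace ℝ (Fin d)) x ^ 2 ∂sphereUniform d =
      ‖x‖ ^ 2 / d := by
  have := sphereUniform_isProbabilityMeasure hd
  have hd0 : (d : ℝ) ≠ 0 := by positivity
  obtain ⟨c, hc⟩ := sphereUniform_integral_inner_pow hd 2
  have hsum : ∑ a : Fin d, ∫ u : UnitSphere d, inner ℝ (u : EuclideanSpace ℝ (Fin d))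
      (EuclideanSpace.basisFun (Fin d) ℝ a) ^ 2 ∂sphereUniform d = 1 := by
    rw [← integral_finsetSum _ fun a _ => integrable_of_continuous _ (by fun_prop)]
    have : ∀ u : UnitSphere d, ∑ a : Fin d, inner ℝ (u : EuclideanSpace ℝ (Fin d))
      (EuclideanSpace.basisFun (Fin d) ℝ a) ^ 2 = 1 := fun u => by
      rw [OrthonormalBasis.sum_sq_inner_left]; simp
    simp_rw [this]
    simp
  simp_rw [hc] at hsum
  simp only [OrthonormalBasis.norm_eq_one, one_pow, mul_one, Finset.sum_const, Finset.card_univ,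
    Fintype.card_fin, nsmul_eq_mul] at hsum
  rw [hc, eq_div_iff hd0]
  linear_combination ‖x‖ ^ 2 * hsum

/-- Polarization, `12 a² b² = (a + b)⁴ + (a - b)⁴ - 2a⁴ - 2b⁴`, reduces to fourth moments, known up
to one constant `c`; summing over an orthonormal basis reduces to the second moment and fixes `c`.
-/
theorem sphereUniform_integral_inner_sq_mul_inner_sq {d : ℕ} (hd : 1 ≤ d)
    (x y : EuclideanSpace ℝ (Fin d)) :
    ∫ u : UnitSphere d, inner ℝ (u : EuclideanSpace ℝ (Fin d)) x ^ 2 *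
      inner ℝ (u : EuclideanSpace ℝ (Fin d)) y ^ 2 ∂sphereUniform d =
      (‖x‖ ^ 2 * ‖y‖ ^ 2 + 2 * inner ℝ x y ^ 2) / (d * (d + 2)) := by
  have := sphereUniform_isProbabilityMeasure hd
  have hd0 : (d : ℝ) ≠ 0 := by positivity
  obtain ⟨c, hc⟩ := sphereUniform_integral_inner_pow hd 4
  have hpol : ∀ x y : EuclideanSpace ℝ (Fin d),
      ∫ u : UnitSphere d, inner ℝ (u : EuclideanSpace ℝ (Fin d)) x ^ 2 *
        inner ℝ (u : EuclideanSpace ℝ (Fin d)) y ^ 2 ∂sphereUniform d =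
      c / 3 * (‖x‖ ^ 2 * ‖y‖ ^ 2 + 2 * inner ℝ x y ^ 2) := by
    intro x y
    have hpt : ∀ u : UnitSphere d, inner ℝ (u : EuclideanSpace ℝ (Fin d)) x ^ 2 *
        inner ℝ (u : EuclideanSpace ℝ (Fin d)) y ^ 2 =
        (1 / 12) * ((inner ℝ (u : EuclideanSpace ℝ (Fin d)) (x + y) ^ 4 +
          inner ℝ (u : EuclideanSpace ℝ (Fin d)) (x - y) ^ 4) -
          (2 * inner ℝ (u : EuclideanSpace ℝ (Fin d)) x ^ 4 +
          2 * inner ℝ (u : EuclideanSpace ℝ (Fin d)) y ^ 4)) := fun u => by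
      rw [inner_add_right, inner_sub_right]; ring
    simp_rw [hpt]
    rw [integral_const_mul, integral_sub, integral_add, integral_add, integral_const_mul,
      integral_const_mul, hc, hc, hc, hc]
    · have h1 := norm_add_sq_real x y
      have h2 := norm_sub_sq_real x y
      have h3 : ‖x + y‖ ^ 4 = (‖x + y‖ ^ 2) ^ 2 := by ring
      have h4 : ‖x - y‖ ^ 4 = (‖x - y‖ ^ 2) ^ 2 := by ring
      rw [h3, h4, h1, h2]
      ring
    all_goals exact integrable_of_continuous _ (by fun_prop)
  have hsum : ∑ a : Fin d, ∫ u : UnitSphere d, inner ℝ (u : EuclideanSpace ℝ (Fin d))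
      (EuclideanSpace.basisFun (Fin d) ℝ ⟨0, hd⟩) ^ 2 * inner ℝ (u : EuclideanSpace ℝ (Fin d))
      (EuclideanSpace.basisFun (Fin d) ℝ a) ^ 2 ∂sphereUniform d = 1 / d := by
    rw [← integral_finsetSum _ fun a _ => integrable_of_continuous _ (by fun_prop)]
    have : ∀ u : UnitSphere d, ∑ a : Fin d, inner ℝ (u : EuclideanSpace ℝ (Fin d))
      (EuclideanSpace.basisFun (Fin d) ℝ ⟨0, hd⟩) ^ 2 * inner ℝ (u : EuclideanSpace ℝ (Fin d))
      (EuclideanSpace.basisFun (Fin d) ℝ a) ^ 2 = inner ℝ (u : EuclideanSpace ℝ (Fin d))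
      (EuclideanSpace.basisFun (Fin d) ℝ ⟨0, hd⟩) ^ 2 := fun u => by
      rw [← Finset.mul_sum, OrthonormalBasis.sum_sq_inner_left]; simp
    simp_rw [this]
    rw [sphereUniform_integral_inner_sq hd]
    simp
  simp_rw [hpol] at hsum
  rw [← Finset.mul_sum, Finset.sum_add_distrib, ← Finset.mul_sum, ← Finset.mul_sum,
    OrthonormalBasis.sum_sq_inner_left] at hsum
  simp only [OrthonormalBasis.norm_eq_one, one_pow, mul_one, Finset.sum_const, Finset.card_univ,
    Fintype.card_fin, nsmul_eq_mul] at hsum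
  have hd2 : (d : ℝ) + 2 ≠ 0 := by positivity
  have hc3 : c / 3 = 1 / (d * (d + 2)) := by
    field_simp at hsum ⊢
    linarith
  rw [hpol, hc3]
  ring

/-! ### Exponential moments of one squared coordinate. -/

theorem inv_sqrt_le_exp {t : ℝ} (ht : |t| ≤ 1 / 4) :
    (√(1 - 2 * t))⁻¹ ≤ Real.exp (t + 2 * t ^ 2) := by
  obtain ⟨h1, h2⟩ := abs_le.1 ht
  have hpos : 0 < 1 - 2 * t := by linarith
  -- With `s = 2t` this is `-log(1 - s) ≤ s + s²` for `|s| ≤ 1/2`. For `s ≤ 0` the linear bound on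
  -- `exp` suffices, since `(1 - s)(1 + s + s²) = 1 - s³`; for `s ≥ 0` the quadratic one is needed.
  have key : 1 ≤ (1 - 2 * t) * Real.exp (2 * t + (2 * t) ^ 2) := by
    rcases le_total 0 t with h | h
    · have := Real.quadratic_le_exp_of_nonneg (x := 2 * t + (2 * t) ^ 2) (by positivity)
      refine le_trans ?_ (mul_le_mul_of_nonneg_left this hpos.le)
      set s := 2 * t with hs
      have hs0 : 0 ≤ s := by linarith
      have hs1 : s ≤ 1 / 2 := by linarith
      have : (1 - s) * (1 + (s + s ^ 2) + (s + s ^ 2) ^ 2 / 2) - 1 =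
          s ^ 2 * ((1 - s) * (1 + s) ^ 2 - 2 * s) / 2 := by ring
      have h3 : 0 ≤ (1 - s) * (1 + s) ^ 2 - 2 * s := by nlinarith [mul_nonneg hs0 hs0]
      have h4 := mul_nonneg (sq_nonneg s) h3
      linarith
    · have := Real.add_one_le_exp (2 * t + (2 * t) ^ 2)
      refine le_trans ?_ (mul_le_mul_of_nonneg_left this hpos.le)
      nlinarith [mul_nonneg (sq_nonneg t) (neg_nonneg.2 h)]
  have hs : 0 < √(1 - 2 * t) := Real.sqrt_pos.2 hpos
  rw [inv_le_iff_one_le_mul₀ hs]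
  have : (1 : ℝ) ^ 2 ≤ (Real.exp (t + 2 * t ^ 2) * √(1 - 2 * t)) ^ 2 := by
    rw [mul_pow, Real.sq_sqrt hpos.le, ← Real.exp_nat_mul, mul_comm, one_pow]
    convert key using 3
    push_cast; ring
  exact le_of_sq_le_sq this (by positivity)

/-- Let `A` scale the direction `v` by `√(1 - 2t)` and fix its orthogonal complement. On the sphere
`‖A u‖² = 1 - 2t⟨u, v⟩² ≤ exp(-2t⟨u, v⟩²)`, so the integrand is dominated by `‖A u‖⁻ᵈ`, whose mean
is exactly `1 / det A = (1 - 2t)^(-1/2)`, as for a squared Gaussian. -/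
theorem sphereUniform_integral_exp_inner_sq_le {d : ℕ} (hd : 1 ≤ d)
    {v : EuclideanSpace ℝ (Fin d)} (hv : ‖v‖ = 1) {t : ℝ} (ht : |t| ≤ 1 / 4) :
    ∫ u : UnitSphere d, Real.exp (t * (d * inner ℝ (u : EuclideanSpace ℝ (Fin d)) v ^ 2 - 1))
      ∂sphereUniform d ≤ Real.exp (2 * t ^ 2) := by
  have := sphereUniform_isProbabilityMeasure hd
  have : Nonempty (Fin d) := ⟨⟨0, hd⟩⟩
  obtain ⟨ht1, ht2⟩ := abs_le.1 ht
  have hpos : 0 < 1 - 2 * t := by linarith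
  set r := √(1 - 2 * t) with hr
  have hr0 : 0 < r := Real.sqrt_pos.2 hpos
  have hr2 : r ^ 2 = 1 - 2 * t := Real.sq_sqrt hpos.le
  set A : EuclideanSpace ℝ (Fin d) →ₗ[ℝ] EuclideanSpace ℝ (Fin d) :=
    LinearMap.transvection (((r - 1) • innerSL ℝ v).toLinearMap) v with hA
  have hdet : LinearMap.det A = r := by
    rw [hA, LinearMap.transvection.det]
    simp [hv]
  have hnorm : ∀ u : UnitSphere d, ‖A u‖ ^ 2 =
      1 - 2 * t * inner ℝ (u : EuclideanSpace ℝ (Fin d)) v ^ 2 := fun u => by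
    have : A u = u + ((r - 1) * inner ℝ v (u : EuclideanSpace ℝ (Fin d))) • v := rfl
    rw [this, norm_add_sq_real, norm_smul, inner_smul_right, hv,
      real_inner_comm, mul_one, Real.norm_eq_abs, sq_abs]
    simp only [norm_eq_of_mem_sphere]
    linear_combination inner ℝ (u : EuclideanSpace ℝ (Fin d)) v ^ 2 * hr2
  have hpt : ∀ u : UnitSphere d, Real.exp (t * (d * inner ℝ (u : EuclideanSpace ℝ (Fin d)) v ^ 2)) ≤
      (‖A u‖ ^ Module.finrank ℝ (EuclideanSpace ℝ (Fin d)))⁻¹ := fun u => by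
    set a := inner ℝ (u : EuclideanSpace ℝ (Fin d)) v ^ 2 with ha
    have ha0 : 0 ≤ a := sq_nonneg _
    have ha1 : a ≤ 1 := by
      have := abs_real_inner_le_norm (u : EuclideanSpace ℝ (Fin d)) v
      rw [hv, norm_eq_of_mem_sphere, mul_one] at this
      rw [ha]
      exact (sq_le_one_iff_abs_le_one _).2 this
    have hlt : 0 < ‖A u‖ := by
      refine lt_of_le_of_ne (norm_nonneg _) fun h => ?_
      have := hnorm u
      rw [← h] at this
      nlinarith
    have hle : ‖A u‖ ≤ Real.exp (-(t * a)) := by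
      refine le_of_sq_le_sq ?_ (Real.exp_pos _).le
      rw [hnorm, ← Real.exp_nat_mul]
      have := Real.add_one_le_exp ((2 : ℕ) * -(t * a))
      push_cast at this ⊢
      linarith
    rw [finrank_euclideanSpace_fin, le_inv_comm₀ (Real.exp_pos _) (by positivity), ← Real.exp_neg]
    calc ‖A u‖ ^ d ≤ Real.exp (-(t * a)) ^ d := by gcongr
      _ = _ := by rw [← Real.exp_nat_mul]; ring_nf
  have hint : ∫ u : UnitSphere d,
      Real.exp (t * (d * inner ℝ (u : EuclideanSpace ℝ (Fin d)) v ^ 2)) ∂sphereUniform d ≤ r⁻¹ := by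
    rw [integral_eq_lintegral_of_nonneg_ae (Eventually.of_forall fun _ => (Real.exp_pos _).le)
      (Continuous.aestronglyMeasurable (by fun_prop))]
    refine ENNReal.toReal_le_of_le_ofReal (by positivity) ?_
    calc _ ≤ ∫⁻ u : UnitSphere d, ENNReal.ofReal
          ((‖A u‖ ^ Module.finrank ℝ (EuclideanSpace ℝ (Fin d)))⁻¹) ∂sphereUniform d :=
        lintegral_mono fun u => ENNReal.ofReal_le_ofReal (hpt u)
      _ = ENNReal.ofReal r⁻¹ := by
        rw [sphereUniform, lintegral_smul_measure,
          toSphere_lintegral_norm_pow_inv volume A (by rw [hdet]; exact hr0.ne'), hdet,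
          abs_of_pos (inv_pos.2 hr0), smul_eq_mul, mul_left_comm, ENNReal.inv_mul_cancel
          (Measure.measure_univ_ne_zero.2 (Measure.toSphere_ne_zero _)) (measure_ne_top _ _),
          mul_one]
  have hsplit : ∀ u : UnitSphere d,
      Real.exp (t * (d * inner ℝ (u : EuclideanSpace ℝ (Fin d)) v ^ 2 - 1)) =
      Real.exp (-t) * Real.exp (t * (d * inner ℝ (u : EuclideanSpace ℝ (Fin d)) v ^ 2)) :=
    fun u => by rw [← Real.exp_add]; ring_nf
  simp_rw [hsplit]
  rw [integral_const_mul]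
  calc _ ≤ Real.exp (-t) * Real.exp (t + 2 * t ^ 2) := by
        gcongr
        exact hint.trans (inv_sqrt_le_exp ht)
    _ = _ := by rw [← Real.exp_add]; ring_nf

/-! ### Concentration of the frame operator, uniformly over directions. -/

theorem randomUnitVectors_isProbabilityMeasure {d : ℕ} (hd : 1 ≤ d) (n : ℕ) :
    IsProbabilityMeasure (randomUnitVectors d n) := by
  have := sphereUniform_isProbabilityMeasure hd
  unfold randomUnitVectors
  infer_instance

/-- The quadratic form of `d ∑ u_i u_iᵀ - n I`. -/
noncomputable def frameDeviation {d n : ℕ} (u : Fin n → UnitSphere d)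
    (v : EuclideanSpace ℝ (Fin d)) : ℝ :=
  ∑ i, (d * inner ℝ (u i : EuclideanSpace ℝ (Fin d)) v ^ 2 - ‖v‖ ^ 2)

theorem Continuous.frameDeviation {d n : ℕ} {X : Type*} [TopologicalSpace X]
    {f : X → Fin n → UnitSphere d} {g : X → EuclideanSpace ℝ (Fin d)}
    (hf : Continuous f) (hg : Continuous g) :
    Continuous fun x => _root_.frameDeviation (f x) (g x) := by
  refine continuous_finsetSum _ fun i _ => ?_
  have hi : Continuous fun x => (f x i : EuclideanSpace ℝ (Fin d)) :=
    continuous_subtype_val.comp ((continuous_apply i).comp hf)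
  exact (continuous_const.mul ((hi.inner hg).pow 2)).sub (hg.norm.pow 2)

theorem randomUnitVectors_integral_exp_frameDeviation_le {d n : ℕ} (hd : 1 ≤ d)
    {v : EuclideanSpace ℝ (Fin d)} (hv : ‖v‖ = 1) {t : ℝ} (ht : |t| ≤ 1 / 4) :
    ∫ u, Real.exp (t * frameDeviation u v) ∂randomUnitVectors d n ≤
      Real.exp (n * (2 * t ^ 2)) := by
  have := sphereUniform_isProbabilityMeasure hd
  have h : ∀ u : Fin n → UnitSphere d, Real.exp (t * frameDeviation u v) =
      ∏ i, Real.exp (t * (d * inner ℝ (u i : EuclideanSpace ℝ (Fin d)) v ^ 2 - 1)) := fun u => by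
    rw [frameDeviation, hv, Finset.mul_sum, Real.exp_sum, one_pow]
  simp_rw [h]
  rw [randomUnitVectors, integral_fintype_prod_eq_pow (fun x : UnitSphere d =>
    Real.exp (t * (d * inner ℝ (x : EuclideanSpace ℝ (Fin d)) v ^ 2 - 1))), Fintype.card_fin,
    Real.exp_nat_mul]
  exact pow_le_pow_left₀ (integral_nonneg fun _ => Real.exp_nonneg _)
    (sphereUniform_integral_exp_inner_sq_le hd hv ht) n

theorem randomUnitVectors_frameDeviation_tail {d n : ℕ} (hd : 1 ≤ d)
    {v : EuclideanSpace ℝ (Fin d)} (hv : ‖v‖ = 1) {x : ℝ} (hx0 : 0 ≤ x) (hx1 : x ≤ 1) :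
    (randomUnitVectors d n).real {u | n * x ≤ |frameDeviation u v|} ≤
      2 * Real.exp (-(n * x ^ 2 / 8)) := by
  have := randomUnitVectors_isProbabilityMeasure hd n
  have hc : Continuous fun u : Fin n → UnitSphere d => frameDeviation u v :=
    continuous_id.frameDeviation continuous_const
  have side : ∀ s : ℝ, |s| = 1 → (randomUnitVectors d n).real
      {u | n * x ≤ s * frameDeviation u v} ≤ Real.exp (-(n * x ^ 2 / 8)) := by
    intro s hs
    have hs2 : s ^ 2 = 1 := by rw [← sq_abs, hs, one_pow]
    -- `t = ± x / 4` minimizes `2 n t² - |t| n x`, giving `-n x² / 8`; the range `|t| ≤ 1/4` is why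
    -- `x ≤ 1` is assumed.
    have hmgf := randomUnitVectors_integral_exp_frameDeviation_le (n := n) hd hv (t := s * (x / 4))
      (by rw [abs_mul, hs, one_mul, abs_of_nonneg (by positivity)]; linarith)
    have hmk := mul_meas_ge_le_integral_of_nonneg (μ := randomUnitVectors d n)
      (f := fun u => Real.exp (s * (x / 4) * frameDeviation u v))
      (Eventually.of_forall fun _ => (Real.exp_pos _).le)
      (integrable_of_continuous _ (by fun_prop)) (Real.exp (x / 4 * (n * x)))
    have hsub : (randomUnitVectors d n).real {u | n * x ≤ s * frameDeviation u v} ≤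
        (randomUnitVectors d n).real {u | Real.exp (x / 4 * (n * x)) ≤
          Real.exp (s * (x / 4) * frameDeviation u v)} := by
      refine measureReal_mono fun u hu => ?_
      have hu' : n * x ≤ s * frameDeviation u v := hu
      refine Real.exp_le_exp.2 ?_
      nlinarith [mul_le_mul_of_nonneg_left hu' (by positivity : 0 ≤ x / 4)]
    have h1 := (mul_le_mul_of_nonneg_left hsub
      (Real.exp_pos (x / 4 * (n * x))).le).trans (hmk.trans hmgf)
    have h2 : Real.exp (n * (2 * (s * (x / 4)) ^ 2)) =
        Real.exp (x / 4 * (n * x)) * Real.exp (-(n * x ^ 2 / 8)) := by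
      rw [← Real.exp_add, mul_pow, hs2]; ring_nf
    rw [h2] at h1
    exact le_of_mul_le_mul_left h1 (Real.exp_pos _)
  calc _ ≤ (randomUnitVectors d n).real ({u | n * x ≤ 1 * frameDeviation u v} ∪
        {u | n * x ≤ -1 * frameDeviation u v}) := by
        refine measureReal_mono fun u hu => ?_
        have hu' : n * x ≤ |frameDeviation u v| := hu
        rcases le_abs.1 hu' with h | h
        · left; simpa using h
        · right; simpa using h
    _ ≤ _ := (measureReal_union_le _ _).trans
        (by linarith [side 1 (by simp), side (-1) (by simp)])

theorem frameDeviation_smul {d n : ℕ} (u : Fin n → UnitSphere d) (r : ℝ)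
    (v : EuclideanSpace ℝ (Fin d)) : frameDeviation u (r • v) = r ^ 2 * frameDeviation u v := by
  simp only [frameDeviation, Finset.mul_sum, inner_smul_right, norm_smul, mul_pow,
    Real.norm_eq_abs, sq_abs]
  exact Finset.sum_congr rfl fun i _ => by ring

theorem abs_frameDeviation_le_mul_norm_sq {d n : ℕ} {u : Fin n → UnitSphere d} {m : ℝ}
    (hm : ∀ v : UnitSphere d, |frameDeviation u v| ≤ m) (v : EuclideanSpace ℝ (Fin d)) :
    |frameDeviation u v| ≤ m * ‖v‖ ^ 2 := by
  rcases eq_or_ne v 0 with rfl | hv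
  · simp [frameDeviation]
  · have h0 : 0 < ‖v‖ := norm_pos_iff.2 hv
    have h := hm ⟨‖v‖⁻¹ • v, by simp [norm_smul, h0.ne']⟩
    rw [frameDeviation_smul, abs_mul, abs_of_nonneg (by positivity), inv_pow,
      ← div_eq_inv_mul, div_le_iff₀ (by positivity)] at h
    exact h

/-- A quadratic form bounded by its maximum `m` on the sphere varies by at most `m / 2` within
distance 1/4 of the maximizer. -/
theorem half_le_abs_frameDeviation {d n : ℕ} {u : Fin n → UnitSphere d} {w : UnitSphere d}
    (hw : ∀ v : UnitSphere d, |frameDeviation u v| ≤ |frameDeviation u w|) {v : UnitSphere d}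
    (hv : dist v w < 1 / 4) : |frameDeviation u w| / 2 ≤ |frameDeviation u v| := by
  obtain ⟨x, hx⟩ : ∃ x : EuclideanSpace ℝ (Fin d), x = v := ⟨_, rfl⟩
  obtain ⟨y, hy⟩ : ∃ y : EuclideanSpace ℝ (Fin d), y = w := ⟨_, rfl⟩
  rw [← hx, ← hy]
  rw [← hy] at hw
  set m := |frameDeviation u y| with hm
  have hm0 : 0 ≤ m := abs_nonneg _
  have hx1 : ‖x‖ = 1 := hx ▸ norm_eq_of_mem_sphere v
  have hy1 : ‖y‖ = 1 := hy ▸ norm_eq_of_mem_sphere w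
  have hxy : ‖x - y‖ < 1 / 4 := by rwa [← dist_eq_norm, hx, hy]
  have h1 := norm_sub_sq_real x y
  have h2 : ‖x - y‖ ^ 2 ≤ (1 / 4) ^ 2 := by gcongr
  -- Polarization with weight 8: `9x - 7y` and `7x - 9y` are, up to sign, `(x + y) ± 8(x - y)`. The
  -- weight balances `‖x + y‖ ≈ 2` against `‖x - y‖ < 1/4`; each squared norm is `130 - 126⟨x, y⟩ <
  -- 8`, so the difference is at most `16 m / 32`.
  have hid : 32 * (frameDeviation u x - frameDeviation u y) =
      frameDeviation u ((9 : ℝ) • x - (7 : ℝ) • y) -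
      frameDeviation u ((7 : ℝ) • x - (9 : ℝ) • y) := by
    simp only [frameDeviation]
    rw [← Finset.sum_sub_distrib, ← Finset.sum_sub_distrib, Finset.mul_sum]
    refine Finset.sum_congr rfl fun i _ => ?_
    rw [norm_sub_sq_real, norm_sub_sq_real, inner_sub_right, inner_sub_right]
    simp only [inner_smul_right, inner_smul_left, norm_smul, Real.norm_eq_abs]
    norm_num
    ring
  have hb1 := abs_frameDeviation_le_mul_norm_sq hw ((9 : ℝ) • x - (7 : ℝ) • y)
  have hb2 := abs_frameDeviation_le_mul_norm_sq hw ((7 : ℝ) • x - (9 : ℝ) • y)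
  rw [norm_sub_sq_real] at hb1 hb2
  simp only [inner_smul_right, inner_smul_left, norm_smul, Real.norm_eq_abs] at hb1 hb2
  rw [hx1, hy1] at hb1 hb2 h1
  norm_num at hb1 hb2
  have hin : 31 / 32 ≤ inner ℝ x y := by linarith
  have hmi := mul_le_mul_of_nonneg_left hin hm0
  rw [abs_le] at hb1 hb2
  have hdiff : |frameDeviation u x - frameDeviation u y| ≤ m / 2 := by
    rw [abs_le]
    constructor <;> nlinarith [hb1.1, hb1.2, hb2.1, hb2.2]
  have h3 := abs_sub_abs_le_abs_sub (frameDeviation u y) (frameDeviation u x)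
  rw [abs_sub_comm] at h3
  linarith

theorem sphereUniform_ball_ge {d : ℕ} (hd : 1 ≤ d) (w : UnitSphere d) :
    ENNReal.ofReal ((1 / 16) ^ d) ≤ sphereUniform d (Metric.ball w (1 / 4)) := by
  have : Nonempty (Fin d) := ⟨⟨0, hd⟩⟩
  have h := Measure.toSphereBallBound_mul_measure_unitBall_le_toSphere_ball
    (volume : Measure (EuclideanSpace ℝ (Fin d))) (ε := 1 / 4) (by norm_num) w
  have hb : (Measure.toSphereBallBound (Module.finrank ℝ (EuclideanSpace ℝ (Fin d))) (1 / 4) :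
      ENNReal) = d * ENNReal.ofReal ((1 / 16) ^ d) := by
    have hmin : min (Real.toNNReal (1 / 4)) 2 / 4 = Real.toNNReal (1 / 16) := by
      ext
      simp
      norm_num
    rw [finrank_euclideanSpace_fin, Measure.toSphereBallBound, if_pos ⟨by omega, by norm_num⟩, hmin,
      ← Real.toNNReal_pow (by norm_num)]
    simp [ENNReal.ofReal]
  rw [hb] at h
  rw [sphereUniform, Measure.smul_apply, smul_eq_mul, ← ENNReal.div_eq_inv_mul,
    ENNReal.le_div_iff_mul_le, Measure.toSphere_apply_univ, finrank_euclideanSpace_fin]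
  · refine le_trans (le_of_eq ?_) h
    ring
  · exact Or.inl (Measure.measure_univ_ne_zero.2 (Measure.toSphere_ne_zero _))
  · exact Or.inl (measure_ne_top _ _)

/-- If some direction exceeds `2x`, so does the maximizer, and a cap of measure at least `16⁻ᵈ`
around it exceeds `x`. Markov applied to the measure of the directions exceeding `x`, with Fubini,
reduces to the tail in a fixed direction. -/
theorem randomUnitVectors_exists_frameDeviation_gt {d n : ℕ} (hd : 1 ≤ d)
    {x : ℝ} (hx0 : 0 ≤ x) (hx1 : x ≤ 1) :
    (randomUnitVectors d n).real {u | ∃ v : UnitSphere d, n * (2 * x) < |frameDeviation u v|} ≤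
      2 * 16 ^ d * Real.exp (-(n * x ^ 2 / 8)) := by
  have := sphereUniform_isProbabilityMeasure hd
  have := randomUnitVectors_isProbabilityMeasure hd n
  set s : Set ((Fin n → UnitSphere d) × UnitSphere d) :=
    {p | n * x ≤ |frameDeviation p.1 p.2|} with hs
  have hsm : MeasurableSet s := by
    exact (isClosed_le continuous_const (continuous_abs.comp (continuous_fst.frameDeviation
      (continuous_subtype_val.comp continuous_snd)))).measurableSet
  have hsub : {u : Fin n → UnitSphere d | ∃ v : UnitSphere d, n * (2 * x) < |frameDeviation u v|} ⊆
      {u | ENNReal.ofReal ((1 / 16) ^ d) ≤ sphereUniform d (Prod.mk u ⁻¹' s)} := by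
    rintro u ⟨v, hv⟩
    have hc : Continuous fun v : UnitSphere d => |frameDeviation u v| :=
      continuous_abs.comp (continuous_const.frameDeviation continuous_subtype_val)
    obtain ⟨w, -, hw⟩ := isCompact_univ.exists_isMaxOn (f := fun v : UnitSphere d =>
      |frameDeviation u v|) ⟨v, trivial⟩ hc.continuousOn
    refine (sphereUniform_ball_ge hd w).trans (measure_mono fun z hz => ?_)
    have hwv : |frameDeviation u v| ≤ |frameDeviation u w| := hw (Set.mem_univ v)
    have := half_le_abs_frameDeviation (fun v => hw (Set.mem_univ v)) hz
    change n * x ≤ |frameDeviation u z|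
    linarith
  have hmk := mul_meas_ge_le_lintegral (μ := randomUnitVectors d n)
    (measurable_measure_prodMk_left (ν := sphereUniform d) hsm) (ENNReal.ofReal ((1 / 16) ^ d))
  rw [← Measure.prod_apply hsm, Measure.prod_apply_symm hsm] at hmk
  have hle : ∫⁻ v, randomUnitVectors d n ((fun u => (u, v)) ⁻¹' s) ∂sphereUniform d ≤
      ENNReal.ofReal (2 * Real.exp (-(n * x ^ 2 / 8))) := by
    calc _ ≤ ∫⁻ _, ENNReal.ofReal (2 * Real.exp (-(n * x ^ 2 / 8))) ∂sphereUniform d := by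
          refine lintegral_mono fun v => ?_
          rw [← ofReal_measureReal]
          exact ENNReal.ofReal_le_ofReal
            (randomUnitVectors_frameDeviation_tail hd (norm_eq_of_mem_sphere v) hx0 hx1)
      _ = _ := by simp
  have h1 := (mul_le_mul_right (measure_mono hsub) (ENNReal.ofReal ((1 / 16) ^ d))).trans
    (hmk.trans hle)
  rw [← ofReal_measureReal, ← ENNReal.ofReal_mul (by positivity),
    ENNReal.ofReal_le_ofReal_iff (by positivity), one_div, inv_pow, inv_mul_le_iff₀ (by positivity)]
    at h1
  linarith

/-! ### From the quadratic form to near double balance. -/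

theorem frameMatrix_quadraticForm {d n : ℕ} (u : Fin n → EuclideanSpace ℝ (Fin d))
    (x : Fin d → ℝ) :
    x ⬝ᵥ (frameMatrix u).mulVec x = ∑ i, inner ℝ (u i) (WithLp.toLp 2 x) ^ 2 := by
  simp only [frameMatrix, Matrix.sum_mulVec, dotProduct_sum, Matrix.vecMulVec_mulVec]
  refine Finset.sum_congr rfl fun i _ => ?_
  simp only [PiLp.inner_apply, dotProduct, sq, Pi.smul_apply, MulOpposite.smul_eq_mul_unop,
    MulOpposite.unop_op, RCLike.inner_apply, conj_trivial, Finset.sum_mul]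
  exact Finset.sum_congr rfl fun a _ => by simp only [mul_comm, mul_assoc]

theorem nearlyDoublyBalanced_of_frameDeviation {d n : ℕ} (hd : 1 ≤ d) (hn : 1 ≤ n) {ε : ℝ}
    (hε : 0 ≤ ε) {u : Fin n → UnitSphere d}
    (h : ∀ v : UnitSphere d, |frameDeviation u v| ≤ n * ε) :
    NearlyDoublyBalanced ε (fun i => (u i : EuclideanSpace ℝ (Fin d))) := by
  have hsize : frameSize (fun i => (u i : EuclideanSpace ℝ (Fin d))) = n := by
    simp [frameSize]
  have hn0 : (n : ℝ) ≠ 0 := by positivity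
  have hd0 : (0 : ℝ) < d := by positivity
  have hnorm : frameNormMatrix (fun i => (u i : EuclideanSpace ℝ (Fin d))) = 1 := by
    simp [frameNormMatrix]
  have hherm : (frameMatrix (fun i => (u i : EuclideanSpace ℝ (Fin d)))).IsHermitian := by
    unfold frameMatrix
    ext a b
    simp [Matrix.sum_apply, Matrix.vecMulVec_apply, mul_comm]
  have hone : ∀ (k : ℕ) (c : ℝ), (c • (1 : Matrix (Fin k) (Fin k) ℝ)).IsHermitian := fun k c => by
    ext a b
    simp [Matrix.one_apply, eq_comm]
  have hform : ∀ x : Fin d → ℝ,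
      d * (x ⬝ᵥ (frameMatrix (fun i => (u i : EuclideanSpace ℝ (Fin d)))).mulVec x) =
      frameDeviation u (WithLp.toLp 2 x) + n * (x ⬝ᵥ x) := fun x => by
    rw [frameMatrix_quadraticForm, frameDeviation, Finset.sum_sub_distrib, Finset.mul_sum,
      EuclideanSpace.real_norm_sq_eq]
    simp [dotProduct, sq]
  have hdev : ∀ x : Fin d → ℝ, |frameDeviation u (WithLp.toLp 2 x)| ≤ n * ε * (x ⬝ᵥ x) :=
    fun x => by
      have := abs_frameDeviation_le_mul_norm_sq h (WithLp.toLp 2 x)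
      rw [EuclideanSpace.real_norm_sq_eq] at this
      simpa [dotProduct, sq] using this
  rw [NearlyDoublyBalanced, hsize, hnorm, div_self hn0]
  refine ⟨?_, ?_, ?_, ?_⟩
  · refine Matrix.PosSemidef.of_dotProduct_mulVec_nonneg (hherm.sub (hone _ _)) fun x => ?_
    rw [star_trivial, Matrix.sub_mulVec, dotProduct_sub, Matrix.smul_mulVec, Matrix.one_mulVec,
      dotProduct_smul, smul_eq_mul]
    have h1 := hform x
    have h2 := (abs_le.1 (hdev x)).1
    refine nonneg_of_mul_nonneg_right (a := (d : ℝ)) ?_ hd0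
    rw [mul_sub, h1]
    field_simp
    linarith
  · refine Matrix.PosSemidef.of_dotProduct_mulVec_nonneg ((hone _ _).sub hherm) fun x => ?_
    rw [star_trivial, Matrix.sub_mulVec, dotProduct_sub, Matrix.smul_mulVec, Matrix.one_mulVec,
      dotProduct_smul, smul_eq_mul]
    have h1 := hform x
    have h2 := (abs_le.1 (hdev x)).2
    refine nonneg_of_mul_nonneg_right (a := (d : ℝ)) ?_ hd0
    rw [mul_sub, h1]
    field_simp
    linarith
  · have : (1 : Matrix (Fin n) (Fin n) ℝ) - ((1 - ε) * 1) • 1 = ε • 1 := by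
      rw [mul_one, sub_smul, one_smul, sub_sub_cancel]
    rw [this]
    exact Matrix.PosSemidef.one.smul hε
  · have : ((1 + ε) * 1) • (1 : Matrix (Fin n) (Fin n) ℝ) - 1 = ε • 1 := by
      rw [mul_one, add_smul, one_smul, add_sub_cancel_left]
    rw [this]
    exact Matrix.PosSemidef.one.smul hε

/-- The factor 80 makes the exponent `n x² / 8` at least `10 d`, and `e^(-10)` beats the base 16
with room for the required 1/200 already at `d = 1`. -/
theorem randomUnitVectors_not_nearlyDoublyBalanced_le {d n : ℕ} (hd : 1 ≤ d) {x : ℝ}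
    (hx0 : 0 ≤ x) (hx1 : x ≤ 1) (hx : 80 * d ≤ n * x ^ 2) :
    (randomUnitVectors d n).real {u | ¬ NearlyDoublyBalanced (2 * x)
      (fun i => (u i : EuclideanSpace ℝ (Fin d)))} ≤ 1 / 200 := by
  have := randomUnitVectors_isProbabilityMeasure hd n
  have hn : 1 ≤ n := by
    rcases Nat.eq_zero_or_pos n with rfl | h
    · have : (1 : ℝ) ≤ d := by exact_mod_cast hd
      norm_num at hx
      linarith
    · exact h
  calc _ ≤ (randomUnitVectors d n).real
        {u | ∃ v : UnitSphere d, n * (2 * x) < |frameDeviation u v|} := by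
        refine measureReal_mono fun u hu => ?_
        by_contra hcon
        refine hu (nearlyDoublyBalanced_of_frameDeviation hd hn (by positivity) fun v => ?_)
        by_contra hlt
        exact hcon ⟨v, not_le.1 hlt⟩
    _ ≤ 2 * 16 ^ d * Real.exp (-(n * x ^ 2 / 8)) :=
        randomUnitVectors_exists_frameDeviation_gt hd hx0 hx1
    _ ≤ 2 * 16 ^ d * Real.exp (d * (-10)) := by
        gcongr
        linarith
    _ = 2 * (16 * Real.exp (-10)) ^ d := by rw [Real.exp_nat_mul, mul_pow]; ring
    _ ≤ 2 * (1 / 400) ^ 1 := by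
        have h10 : (16 : ℝ) * Real.exp (-10) ≤ 1 / 400 := by
          have h1 : (2.7 : ℝ) ^ 10 ≤ Real.exp 10 := by
            have : Real.exp 10 = Real.exp 1 ^ 10 := by rw [← Real.exp_nat_mul]; norm_num
            rw [this]
            gcongr
            linarith [Real.exp_one_gt_d9]
          rw [Real.exp_neg, ← div_eq_mul_inv, div_le_iff₀ (Real.exp_pos _)]
          norm_num at h1 ⊢
          linarith
        gcongr
        calc (16 * Real.exp (-10)) ^ d ≤ (1 / 400) ^ d := by gcongr
          _ ≤ (1 / 400) ^ 1 := pow_le_pow_of_le_one (by norm_num) (by norm_num) hd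
    _ = 1 / 200 := by norm_num

/-! ### The centered kernel and its reproducing identity. -/

/-- The entries of the squared Gram matrix, centered at their mean. -/
noncomputable def centeredKernel {d : ℕ} (x y : UnitSphere d) : ℝ :=
  inner ℝ (x : EuclideanSpace ℝ (Fin d)) (y : EuclideanSpace ℝ (Fin d)) ^ 2 - 1 / d

theorem Continuous.centeredKernel {d : ℕ} {X : Type*} [TopologicalSpace X]
    {f g : X → UnitSphere d} (hf : Continuous f) (hg : Continuous g) :
    Continuous fun x => _root_.centeredKernel (f x) (g x) :=
  (((continuous_subtype_val.comp hf).inner (continuous_subtype_val.comp hg)).pow 2).sub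
    continuous_const

theorem centeredKernel_comm {d : ℕ} (x y : UnitSphere d) :
    centeredKernel x y = centeredKernel y x := by
  rw [centeredKernel, real_inner_comm, centeredKernel]

theorem centeredKernel_self {d : ℕ} (x : UnitSphere d) : centeredKernel x x = 1 - 1 / d := by
  simp [centeredKernel]

theorem centeredKernel_sq_le_one {d : ℕ} (hd : 1 ≤ d) (x y : UnitSphere d) :
    centeredKernel x y ^ 2 ≤ 1 := by
  rw [sq_le_one_iff_abs_le_one, centeredKernel, abs_le]
  have h := abs_real_inner_le_norm (x : EuclideanSpace ℝ (Fin d)) y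
  rw [norm_eq_of_mem_sphere, norm_eq_of_mem_sphere, mul_one] at h
  have h1 := (sq_le_one_iff_abs_le_one _).2 h
  have h2 := sq_nonneg (inner ℝ (x : EuclideanSpace ℝ (Fin d)) (y : EuclideanSpace ℝ (Fin d)))
  have hd1 : (1 : ℝ) ≤ d := by exact_mod_cast hd
  have h3 : (1 : ℝ) / d ≤ 1 := (div_le_one (by positivity)).2 hd1
  have h4 : (0 : ℝ) ≤ 1 / d := by positivity
  constructor <;> linarith

/-- The eigenvalue of the integral operator of `centeredKernel`. -/
noncomputable def kernelEigenvalue (d : ℕ) : ℝ := 2 / (d * (d + 2))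

theorem kernelEigenvalue_nonneg (d : ℕ) : 0 ≤ kernelEigenvalue d := by
  unfold kernelEigenvalue; positivity

/-- Expanding the product leaves only second and fourth moments. The kernel is thus
`kernelEigenvalue d` times an idempotent for convolution, the reason `K²` resembles a multiple of
`K`. -/
theorem integral_centeredKernel_mul {d : ℕ} (hd : 1 ≤ d) (x y : UnitSphere d) :
    ∫ z, centeredKernel x z * centeredKernel z y ∂sphereUniform d =
      kernelEigenvalue d * centeredKernel x y := by
  have := sphereUniform_isProbabilityMeasure hd
  have hd0 : (d : ℝ) ≠ 0 := by positivity
  have hd2 : (d : ℝ) + 2 ≠ 0 := by positivity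
  have hpt : ∀ z : UnitSphere d, centeredKernel x z * centeredKernel z y =
      inner ℝ (z : EuclideanSpace ℝ (Fin d)) x ^ 2 * inner ℝ (z : EuclideanSpace ℝ (Fin d)) y ^ 2 -
      (1 / d * (inner ℝ (z : EuclideanSpace ℝ (Fin d)) x ^ 2 +
        inner ℝ (z : EuclideanSpace ℝ (Fin d)) y ^ 2) - (1 / d) ^ 2) := fun z => by
    rw [centeredKernel, centeredKernel, real_inner_comm]; ring
  simp_rw [hpt]
  rw [integral_sub, integral_sub, integral_const_mul, integral_add,
    sphereUniform_integral_inner_sq_mul_inner_sq hd, sphereUniform_integral_inner_sq hd,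
    sphereUniform_integral_inner_sq hd, kernelEigenvalue, centeredKernel]
  · simp only [norm_eq_of_mem_sphere, integral_const, probReal_univ, smul_eq_mul]
    field_simp
    ring
  all_goals exact integrable_of_continuous _ (by fun_prop)

theorem integral_centeredKernel_sq_le {d : ℕ} (hd : 1 ≤ d) (x : UnitSphere d) :
    ∫ z, centeredKernel x z ^ 2 ∂sphereUniform d ≤ kernelEigenvalue d := by
  have h := integral_centeredKernel_mul hd x x
  simp_rw [centeredKernel_comm _ x, ← sq, centeredKernel_self] at h
  rw [h]
  have : (0 : ℝ) ≤ 1 / d := by positivity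
  nlinarith [kernelEigenvalue_nonneg d]

/-! ### Resampling one coordinate, used as conditional expectation given the others. -/

theorem measurePreserving_update {ι X : Type*} [Fintype ι] [DecidableEq ι] [MeasurableSpace X]
    (μ : Measure X) [IsProbabilityMeasure μ] (l : ι) :
    MeasurePreserving (fun p : (ι → X) × X => Function.update p.1 l p.2)
      ((Measure.pi fun _ => μ).prod μ) (Measure.pi fun _ => μ) := by
  have hm : Measurable fun p : (ι → X) × X => Function.update p.1 l p.2 := by
    refine measurable_pi_lambda _ fun i => ?_
    rcases eq_or_ne i l with rfl | h
    · simpa using measurable_snd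
    · simp only [Function.update_of_ne h]
      exact (measurable_pi_apply i).comp measurable_fst
  refine ⟨hm, (Measure.pi_eq fun s hs => ?_).symm⟩
  rw [Measure.map_apply hm (MeasurableSet.univ_pi hs)]
  have : (fun p : (ι → X) × X => Function.update p.1 l p.2) ⁻¹' (Set.univ.pi s) =
      (Set.univ.pi (Function.update s l Set.univ)) ×ˢ s l := by
    ext p
    simp only [Set.mem_preimage, Set.mem_pi, Set.mem_univ, true_imp_iff, Set.mem_prod]
    constructor
    · refine fun h => ⟨fun i => ?_, by simpa using h l⟩
      rcases eq_or_ne i l with rfl | hi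
      · simp
      · simpa [hi] using h i
    · rintro ⟨h1, h2⟩ i
      rcases eq_or_ne i l with rfl | hi
      · simpa using h2
      · simpa [hi] using h1 i
  rw [this, Measure.prod_prod, Measure.pi_pi, ← Finset.mul_prod_erase _ _ (Finset.mem_univ l),
    ← Finset.mul_prod_erase _ (fun i => μ (s i)) (Finset.mem_univ l)]
  simp only [Function.update_self, measure_univ, one_mul]
  rw [mul_comm]
  congr 1
  exact Finset.prod_congr rfl fun i hi => by
    rw [Function.update_of_ne (Finset.ne_of_mem_erase hi)]

theorem integral_eq_integral_update {d n : ℕ} (hd : 1 ≤ d) (l : Fin n)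
    {F : (Fin n → UnitSphere d) → ℝ} (hF : Continuous F) :
    ∫ u, F u ∂randomUnitVectors d n =
      ∫ u, ∫ x, F (Function.update u l x) ∂sphereUniform d ∂randomUnitVectors d n := by
  have := sphereUniform_isProbabilityMeasure hd
  have hc : Continuous fun p : (Fin n → UnitSphere d) × UnitSphere d =>
      F (Function.update p.1 l p.2) := hF.comp (continuous_fst.update l continuous_snd)
  have hmp := measurePreserving_update (sphereUniform d) l
  rw [randomUnitVectors, ← hmp.map_eq, integral_map hmp.measurable.aemeasurable
    hF.aestronglyMeasurable, hmp.map_eq]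
  exact integral_prod _ (integrable_of_continuous _ hc)

/-! ### Second moments of the kernel matrix and of its square. -/

section GramMoments

variable {d n : ℕ}

theorem integral_centeredKernel_sq_entry_le (hd : 1 ≤ d) {i j : Fin n} (h : i ≠ j) :
    ∫ u, centeredKernel (u i) (u j) ^ 2 ∂randomUnitVectors d n ≤ kernelEigenvalue d := by
  have := randomUnitVectors_isProbabilityMeasure hd n
  have := sphereUniform_isProbabilityMeasure hd
  rw [integral_eq_integral_update hd j
    (((continuous_apply i).centeredKernel (continuous_apply j)).fun_pow 2)]
  simp only [Function.update_self, Function.update_of_ne h]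
  calc _ ≤ ∫ _, kernelEigenvalue d ∂randomUnitVectors d n := by
        refine integral_mono_of_nonneg (Eventually.of_forall fun u =>
          integral_nonneg fun _ => sq_nonneg _) (integrable_const _) (Eventually.of_forall fun u =>
          integral_centeredKernel_sq_le hd (u i))
    _ = _ := by simp

theorem integral_centeredKernel_sq_mul_sq_entry_le (hd : 1 ≤ d) {i j l : Fin n} (hij : i ≠ j)
    (hil : i ≠ l) (hjl : j ≠ l) :
    ∫ u, centeredKernel (u i) (u j) ^ 2 * centeredKernel (u i) (u l) ^ 2 ∂randomUnitVectors d n ≤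
      kernelEigenvalue d ^ 2 := by
  have := randomUnitVectors_isProbabilityMeasure hd n
  have := sphereUniform_isProbabilityMeasure hd
  have hcij : Continuous fun u : Fin n → UnitSphere d => centeredKernel (u i) (u j) ^ 2 :=
    ((continuous_apply i).centeredKernel (continuous_apply j)).fun_pow 2
  rw [integral_eq_integral_update hd l
    (hcij.fun_mul (((continuous_apply i).centeredKernel (continuous_apply l)).fun_pow 2))]
  simp only [Function.update_self, Function.update_of_ne hil, Function.update_of_ne hjl]
  calc _ ≤ ∫ u, centeredKernel (u i) (u j) ^ 2 * kernelEigenvalue d ∂randomUnitVectors d n := by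
        refine integral_mono_of_nonneg (Eventually.of_forall fun u =>
          integral_nonneg fun _ => by positivity)
          (integrable_of_continuous _ (hcij.fun_mul continuous_const)) (Eventually.of_forall fun u => ?_)
        simp only [integral_const_mul]
        exact mul_le_mul_of_nonneg_left (integral_centeredKernel_sq_le hd (u i)) (sq_nonneg _)
    _ ≤ _ := by
        rw [integral_mul_const, sq]
        exact mul_le_mul_of_nonneg_right (integral_centeredKernel_sq_entry_le hd hij)
          (kernelEigenvalue_nonneg d)

/-- The fluctuation of `k(u_i, u_l) k(u_l, u_j)` around its conditional mean. -/
noncomputable def kernelFluctuation (u : Fin n → UnitSphere d) (i j l : Fin n) : ℝ :=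
  centeredKernel (u i) (u l) * centeredKernel (u l) (u j) -
    kernelEigenvalue d * centeredKernel (u i) (u j)

theorem continuous_kernelFluctuation (i j l : Fin n) :
    Continuous fun u : Fin n → UnitSphere d => kernelFluctuation u i j l :=
  (((continuous_apply i).centeredKernel (continuous_apply l)).fun_mul
    ((continuous_apply l).centeredKernel (continuous_apply j))).fun_sub
    (continuous_const.fun_mul ((continuous_apply i).centeredKernel (continuous_apply j)))

theorem integral_kernelFluctuation_update (hd : 1 ≤ d) (u : Fin n → UnitSphere d) {i j l : Fin n}
    (hil : i ≠ l) (hjl : j ≠ l) :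
    ∫ x, kernelFluctuation (Function.update u l x) i j l ∂sphereUniform d = 0 := by
  have := sphereUniform_isProbabilityMeasure hd
  simp only [kernelFluctuation, Function.update_self, Function.update_of_ne hil,
    Function.update_of_ne hjl]
  rw [integral_sub, integral_centeredKernel_mul hd]
  · simp
  · exact integrable_of_continuous _ ((continuous_const.centeredKernel continuous_id).fun_mul
      (continuous_id.centeredKernel continuous_const))
  · exact integrable_const _

/-- Resampling `u m` leaves the first factor unchanged and averages the second to zero, so the
fluctuations over distinct intermediate indices are uncorrelated. -/
theorem integral_kernelFluctuation_mul (hd : 1 ≤ d) {i j l m : Fin n}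
    (him : i ≠ m) (hjm : j ≠ m) (hlm : l ≠ m) :
    ∫ u, kernelFluctuation u i j l * kernelFluctuation u i j m ∂randomUnitVectors d n = 0 := by
  rw [integral_eq_integral_update hd m
    ((continuous_kernelFluctuation i j l).fun_mul (continuous_kernelFluctuation i j m))]
  have h : ∀ (u : Fin n → UnitSphere d) x, kernelFluctuation (Function.update u m x) i j l =
      kernelFluctuation u i j l := fun u x => by
    simp only [kernelFluctuation, Function.update_of_ne hlm, Function.update_of_ne him,
      Function.update_of_ne hjm]
  simp only [h, integral_const_mul, integral_kernelFluctuation_update hd _ him hjm, mul_zero,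
    integral_zero]

theorem integral_kernelFluctuation_sq_le (hd : 1 ≤ d) {i j l : Fin n}
    (hij : i ≠ j) (hil : i ≠ l) (hjl : j ≠ l) :
    ∫ u, kernelFluctuation u i j l ^ 2 ∂randomUnitVectors d n ≤ kernelEigenvalue d ^ 2 := by
  have := randomUnitVectors_isProbabilityMeasure hd n
  have hcij : Continuous fun u : Fin n → UnitSphere d => centeredKernel (u i) (u j) :=
    (continuous_apply i).centeredKernel (continuous_apply j)
  have hcli : Continuous fun u : Fin n → UnitSphere d => centeredKernel (u l) (u i) :=
    (continuous_apply l).centeredKernel (continuous_apply i)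
  have hclj : Continuous fun u : Fin n → UnitSphere d => centeredKernel (u l) (u j) :=
    (continuous_apply l).centeredKernel (continuous_apply j)
  have hcross : ∫ u, centeredKernel (u i) (u j) * kernelFluctuation u i j l
      ∂randomUnitVectors d n = 0 := by
    rw [integral_eq_integral_update hd l (hcij.fun_mul (continuous_kernelFluctuation i j l))]
    simp only [Function.update_of_ne hil, Function.update_of_ne hjl, integral_const_mul,
      integral_kernelFluctuation_update hd _ hil hjl, mul_zero, integral_zero]
  -- With `P` the product of the two kernels and `F = P - αk`, one has `F² = P² - α²k² - 2αkF`; the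
  -- last term has mean zero and the middle one only helps.
  have hpt : ∀ u : Fin n → UnitSphere d, kernelFluctuation u i j l ^ 2 =
      (centeredKernel (u l) (u i) ^ 2 * centeredKernel (u l) (u j) ^ 2 -
      (kernelEigenvalue d) ^ 2 * centeredKernel (u i) (u j) ^ 2) -
      2 * kernelEigenvalue d * (centeredKernel (u i) (u j) * kernelFluctuation u i j l) :=
    fun u => by
      rw [kernelFluctuation, centeredKernel_comm (u i) (u l)]; ring
  simp_rw [hpt]
  rw [integral_sub, integral_sub, integral_const_mul, integral_const_mul, hcross]
  · have h1 := integral_centeredKernel_sq_mul_sq_entry_le hd hil.symm hjl.symm hij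
    have h2 : 0 ≤ ∫ u, centeredKernel (u i) (u j) ^ 2 ∂randomUnitVectors d n :=
      integral_nonneg fun _ => sq_nonneg _
    have h3 := mul_nonneg (sq_nonneg (kernelEigenvalue d)) h2
    linarith
  · exact integrable_of_continuous _ ((hcli.fun_pow 2).fun_mul (hclj.fun_pow 2))
  · exact integrable_of_continuous _ (continuous_const.fun_mul (hcij.fun_pow 2))
  · exact integrable_of_continuous _ (((hcli.fun_pow 2).fun_mul (hclj.fun_pow 2)).fun_sub
      (continuous_const.fun_mul (hcij.fun_pow 2)))
  · exact integrable_of_continuous _ (continuous_const.fun_mul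
      (hcij.fun_mul (continuous_kernelFluctuation i j l)))

/-- The off-diagonal part of the centered squared Gram matrix. -/
noncomputable def kernelMatrix (u : Fin n → UnitSphere d) : Matrix (Fin n) (Fin n) ℝ :=
  Matrix.of fun i j => if i = j then 0 else centeredKernel (u i) (u j)

theorem continuous_kernelMatrix_apply (i j : Fin n) :
    Continuous fun u : Fin n → UnitSphere d => kernelMatrix u i j := by
  rcases eq_or_ne i j with rfl | h
  · simpa [kernelMatrix] using continuous_const
  · simpa [kernelMatrix, h] using (continuous_apply i).centeredKernel (continuous_apply j)

/-- The deviation of the square of `kernelMatrix` from the multiple of `kernelMatrix` that it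
equals in the mean off the diagonal. -/
noncomputable def squareDeviation (u : Fin n → UnitSphere d) : Matrix (Fin n) (Fin n) ℝ :=
  kernelMatrix u * kernelMatrix u - (((n : ℝ) - 2) * kernelEigenvalue d) • kernelMatrix u

theorem squareDeviation_diag (u : Fin n → UnitSphere d) (i : Fin n) :
    squareDeviation u i i = ∑ l ∈ Finset.univ.erase i, centeredKernel (u i) (u l) ^ 2 := by
  rw [squareDeviation, Matrix.sub_apply, Matrix.mul_apply, Matrix.smul_apply,
    ← Finset.add_sum_erase _ _ (Finset.mem_univ i)]
  simp only [kernelMatrix, Matrix.of_apply, if_true, mul_zero, smul_zero, zero_add, sub_zero]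
  refine Finset.sum_congr rfl fun l hl => ?_
  have hl' := Finset.ne_of_mem_erase hl
  rw [if_neg hl'.symm, if_neg hl', centeredKernel_comm (u l), sq]

theorem squareDeviation_offDiag (u : Fin n → UnitSphere d) {i j : Fin n} (h : i ≠ j) :
    squareDeviation u i j = ∑ l ∈ (Finset.univ.erase i).erase j, kernelFluctuation u i j l := by
  have hj : j ∈ Finset.univ.erase i := Finset.mem_erase.2 ⟨h.symm, Finset.mem_univ j⟩
  have hcard : ((((Finset.univ : Finset (Fin n)).erase i).erase j).card : ℝ) = (n : ℝ) - 2 := by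
    have h1 := Finset.card_erase_add_one (Finset.mem_univ i)
    have h2 := Finset.card_erase_add_one hj
    rw [Finset.card_univ, Fintype.card_fin] at h1
    have h3 : (((Finset.univ.erase i).erase j).card : ℝ) + 1 + 1 = n := by
      exact_mod_cast congrArg (· + 1) h2 |>.trans h1
    linarith
  rw [squareDeviation, Matrix.sub_apply, Matrix.mul_apply, Matrix.smul_apply,
    ← Finset.add_sum_erase _ _ (Finset.mem_univ i), ← Finset.add_sum_erase _ _ hj]
  simp only [kernelFluctuation, Finset.sum_sub_distrib, Finset.sum_const, nsmul_eq_mul, hcard]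
  simp only [kernelMatrix, Matrix.of_apply, if_true, mul_zero, zero_mul, zero_add, if_neg h,
    smul_eq_mul]
  rw [mul_assoc]
  congr 1
  refine Finset.sum_congr rfl fun l hl => ?_
  have hl1 := Finset.ne_of_mem_erase hl
  have hl2 := Finset.ne_of_mem_erase (Finset.mem_of_mem_erase hl)
  rw [if_neg hl2.symm, if_neg hl1]

theorem continuous_squareDeviation_apply (i j : Fin n) :
    Continuous fun u : Fin n → UnitSphere d => squareDeviation u i j := by
  simp only [squareDeviation, Matrix.sub_apply, Matrix.mul_apply, Matrix.smul_apply]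
  exact (continuous_finsetSum _ fun l _ => (continuous_kernelMatrix_apply i l).fun_mul
    (continuous_kernelMatrix_apply l j)).fun_sub ((continuous_kernelMatrix_apply i j).fun_const_smul _)

/-- Expanding the square of the row sum, equal indices contribute at most `α` each because the
kernel is bounded by 1, and distinct ones at most `α²`. -/
theorem integral_squareDeviation_diag_sq_le (hd : 1 ≤ d) (i : Fin n) :
    ∫ u, squareDeviation u i i ^ 2 ∂randomUnitVectors d n ≤
      n * kernelEigenvalue d + n ^ 2 * kernelEigenvalue d ^ 2 := by
  have := randomUnitVectors_isProbabilityMeasure hd n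
  have hc : ∀ l, Continuous fun u : Fin n → UnitSphere d => centeredKernel (u i) (u l) ^ 2 :=
    fun l => ((continuous_apply i).centeredKernel (continuous_apply l)).fun_pow 2
  have hcard : ((Finset.univ.erase i).card : ℝ) ≤ n := by
    exact_mod_cast (Finset.card_le_univ _).trans (Fintype.card_fin n).le
  have ha := kernelEigenvalue_nonneg d
  simp_rw [squareDeviation_diag, sq (∑ l ∈ _, _), Finset.sum_mul_sum]
  rw [integral_finsetSum _ fun l _ => integrable_of_continuous _
    (continuous_finsetSum _ fun m _ => (hc l).fun_mul (hc m))]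
  have hrow : ∀ l ∈ Finset.univ.erase i, ∫ u : Fin n → UnitSphere d, ∑ m ∈ Finset.univ.erase i,
      centeredKernel (u i) (u l) ^ 2 * centeredKernel (u i) (u m) ^ 2 ∂randomUnitVectors d n ≤
      kernelEigenvalue d + n * kernelEigenvalue d ^ 2 := by
    intro l hl
    have hil := (Finset.ne_of_mem_erase hl).symm
    rw [integral_finsetSum _ fun m _ => integrable_of_continuous _ ((hc l).fun_mul (hc m)),
      ← Finset.add_sum_erase _ _ hl]
    refine add_le_add ?_ ?_
    · refine le_trans (integral_mono (integrable_of_continuous _ ((hc l).fun_mul (hc l)))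
        (integrable_of_continuous _ (hc l)) fun u => ?_)
        (integral_centeredKernel_sq_entry_le hd hil)
      exact mul_le_of_le_one_right (sq_nonneg _) (centeredKernel_sq_le_one hd _ _)
    · calc _ ≤ ∑ m ∈ (Finset.univ.erase i).erase l, kernelEigenvalue d ^ 2 := by
            refine Finset.sum_le_sum fun m hm => ?_
            exact integral_centeredKernel_sq_mul_sq_entry_le hd hil
              (Finset.ne_of_mem_erase (Finset.mem_of_mem_erase hm)).symm
              (Finset.ne_of_mem_erase hm).symm
        _ ≤ _ := by
            rw [Finset.sum_const, nsmul_eq_mul]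
            gcongr
            exact_mod_cast (Finset.card_le_univ _).trans (Fintype.card_fin n).le
  calc _ ≤ ∑ l ∈ Finset.univ.erase i, (kernelEigenvalue d + n * kernelEigenvalue d ^ 2) :=
        Finset.sum_le_sum hrow
    _ ≤ n * (kernelEigenvalue d + n * kernelEigenvalue d ^ 2) := by
        rw [Finset.sum_const, nsmul_eq_mul]
        gcongr
    _ = _ := by ring

/-- Orthogonality of the fluctuations removes all cross terms, so the bound grows like `n` and not
`n²`. -/
theorem integral_squareDeviation_offDiag_sq_le (hd : 1 ≤ d) {i j : Fin n} (hij : i ≠ j) :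
    ∫ u, squareDeviation u i j ^ 2 ∂randomUnitVectors d n ≤ n * kernelEigenvalue d ^ 2 := by
  have := randomUnitVectors_isProbabilityMeasure hd n
  have hc := fun l => continuous_kernelFluctuation (d := d) i j l
  simp_rw [squareDeviation_offDiag _ hij, sq (∑ l ∈ _, _), Finset.sum_mul_sum]
  rw [integral_finsetSum _ fun l _ => integrable_of_continuous _
    (continuous_finsetSum _ fun m _ => (hc l).fun_mul (hc m))]
  have hmem : ∀ l ∈ (Finset.univ.erase i).erase j, i ≠ l ∧ j ≠ l := fun l hl =>
    ⟨(Finset.ne_of_mem_erase (Finset.mem_of_mem_erase hl)).symm, (Finset.ne_of_mem_erase hl).symm⟩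
  have hrow : ∀ l ∈ (Finset.univ.erase i).erase j, ∫ u : Fin n → UnitSphere d,
      ∑ m ∈ (Finset.univ.erase i).erase j, kernelFluctuation u i j l * kernelFluctuation u i j m
        ∂randomUnitVectors d n ≤ kernelEigenvalue d ^ 2 := by
    intro l hl
    rw [integral_finsetSum _ fun m _ => integrable_of_continuous _ ((hc l).fun_mul (hc m)),
      Finset.sum_eq_single_of_mem l hl fun m hm hml => integral_kernelFluctuation_mul hd
        (hmem m hm).1 (hmem m hm).2 hml.symm]
    simp_rw [← sq]
    exact integral_kernelFluctuation_sq_le hd hij (hmem l hl).1 (hmem l hl).2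
  calc _ ≤ ∑ l ∈ (Finset.univ.erase i).erase j, kernelEigenvalue d ^ 2 := Finset.sum_le_sum hrow
    _ ≤ _ := by
      rw [Finset.sum_const, nsmul_eq_mul]
      gcongr
      exact_mod_cast (Finset.card_le_univ _).trans (Fintype.card_fin n).le

theorem integral_sum_squareDeviation_sq_le (hd : 1 ≤ d) :
    ∫ u, ∑ i, ∑ j, squareDeviation u i j ^ 2 ∂randomUnitVectors d n ≤
      n ^ 2 * kernelEigenvalue d + 2 * n ^ 3 * kernelEigenvalue d ^ 2 := by
  have := randomUnitVectors_isProbabilityMeasure hd n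
  have hc := fun i j => (continuous_squareDeviation_apply (d := d) (n := n) i j).fun_pow 2
  rw [integral_finsetSum _ fun i _ => integrable_of_continuous _
    (continuous_finsetSum _ fun j _ => hc i j)]
  calc _ ≤ ∑ _i : Fin n, ((n * kernelEigenvalue d + n ^ 2 * kernelEigenvalue d ^ 2) +
        n * (n * kernelEigenvalue d ^ 2)) := by
        refine Finset.sum_le_sum fun i _ => ?_
        rw [integral_finsetSum _ fun j _ => integrable_of_continuous _ (hc i j),
          ← Finset.add_sum_erase _ _ (Finset.mem_univ i)]
        refine add_le_add (integral_squareDeviation_diag_sq_le hd i) ?_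
        calc _ ≤ ∑ j ∈ Finset.univ.erase i, n * kernelEigenvalue d ^ 2 :=
              Finset.sum_le_sum fun j hj => integral_squareDeviation_offDiag_sq_le hd
                (Finset.ne_of_mem_erase hj).symm
          _ ≤ _ := by
              rw [Finset.sum_const, nsmul_eq_mul]
              gcongr
              exact_mod_cast (Finset.card_le_univ _).trans (Fintype.card_fin n).le
    _ = _ := by
        rw [Finset.sum_const, Finset.card_univ, Fintype.card_fin, nsmul_eq_mul]
        ring

end GramMoments

/-! ### Deterministic spectral bounds. -/

theorem dotProduct_sq_le {n : ℕ} (a b : Fin n → ℝ) : (a ⬝ᵥ b) ^ 2 ≤ (a ⬝ᵥ a) * (b ⬝ᵥ b) := by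
  have h := Finset.sum_mul_sq_le_sq_mul_sq Finset.univ a b
  simpa only [dotProduct, ← sq] using h

theorem dotProduct_mulVec_sq_le {n : ℕ} (Q : Matrix (Fin n) (Fin n) ℝ) (a : Fin n → ℝ) :
    (a ⬝ᵥ Q.mulVec a) ^ 2 ≤ (∑ i, ∑ j, Q i j ^ 2) * (a ⬝ᵥ a) ^ 2 := by
  have ha : 0 ≤ a ⬝ᵥ a := Finset.sum_nonneg fun i _ => mul_self_nonneg (a i)
  have h1 : Q.mulVec a ⬝ᵥ Q.mulVec a ≤ (∑ i, ∑ j, Q i j ^ 2) * (a ⬝ᵥ a) := by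
    rw [dotProduct, Finset.sum_mul]
    refine Finset.sum_le_sum fun i _ => ?_
    have := dotProduct_sq_le (Q i) a
    rw [← sq]
    simpa only [Matrix.mulVec, dotProduct, ← sq] using this
  calc _ ≤ (a ⬝ᵥ a) * (Q.mulVec a ⬝ᵥ Q.mulVec a) := dotProduct_sq_le _ _
    _ ≤ (a ⬝ᵥ a) * ((∑ i, ∑ j, Q i j ^ 2) * (a ⬝ᵥ a)) := mul_le_mul_of_nonneg_left h1 ha
    _ = _ := by ring

/-- Put `κ = aᵀKa` and `s = aᵀa`. If `κ > 0`, Cauchy–Schwarz and `|Ka|² = aᵀK²a ≤ q² s + cκ` give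
`κ² ≤ q² s² + b s κ`, which is impossible when `κ > (b + q) s`. -/
theorem dotProduct_mulVec_le_of_sq_near_smul {n : ℕ} {K : Matrix (Fin n) (Fin n) ℝ}
    (hK : K.transpose = K) {b c q : ℝ} (hcb : c ≤ b) (hb : 0 ≤ b) (hq : 0 ≤ q)
    (h : ∑ i, ∑ j, (K * K - c • K) i j ^ 2 ≤ q ^ 4) (a : Fin n → ℝ) :
    a ⬝ᵥ K.mulVec a ≤ (b + q) * (a ⬝ᵥ a) := by
  have ha : 0 ≤ a ⬝ᵥ a := Finset.sum_nonneg fun i _ => mul_self_nonneg (a i)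
  have hQ : a ⬝ᵥ (K * K - c • K).mulVec a ≤ q ^ 2 * (a ⬝ᵥ a) := by
    refine (abs_le_of_sq_le_sq' ?_ (by positivity)).2
    calc _ ≤ _ := dotProduct_mulVec_sq_le _ a
      _ ≤ q ^ 4 * (a ⬝ᵥ a) ^ 2 := by gcongr
      _ = _ := by ring
  have hKK : a ⬝ᵥ (K * K).mulVec a = K.mulVec a ⬝ᵥ K.mulVec a := by
    rw [← Matrix.mulVec_mulVec, Matrix.dotProduct_mulVec, ← Matrix.mulVec_transpose, hK]
  rw [Matrix.sub_mulVec, dotProduct_sub, hKK, Matrix.smul_mulVec, dotProduct_smul,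
    smul_eq_mul] at hQ
  have hcs := dotProduct_sq_le a (K.mulVec a)
  set κ := a ⬝ᵥ K.mulVec a
  set s := a ⬝ᵥ a
  by_contra hlt
  push Not at hlt
  have hκ : 0 < κ := lt_of_le_of_lt (by positivity) hlt
  have h1 : κ ^ 2 ≤ s * (q ^ 2 * s + b * κ) := by
    refine hcs.trans (mul_le_mul_of_nonneg_left ?_ ha)
    have := mul_le_mul_of_nonneg_right hcb hκ.le
    linarith
  have h2 : 0 < κ - b * s - q * s := by linarith
  have h3 : 0 ≤ q * s := by positivity
  have h4 : 0 ≤ b * s := by positivity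
  nlinarith [mul_pos hκ h2, mul_nonneg h3 h2.le, mul_nonneg h3 h4]

/-- The plane spanned by the top two eigenvectors meets the sum-zero hyperplane, and on that plane
the form is at least `λ₂` times the squared norm. Nonnegativity of `β` covers the default value 0.
-/
theorem secondEigenvalue_le {n : ℕ} {A : Matrix (Fin n) (Fin n) ℝ} (hA : A.IsHermitian) {β : ℝ}
    (hβ : 0 ≤ β) (h : ∀ a : Fin n → ℝ, ∑ i, a i = 0 → a ⬝ᵥ A.mulVec a ≤ β * (a ⬝ᵥ a)) :
    secondEigenvalue hA ≤ β := by
  unfold secondEigenvalue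
  split_ifs with hn
  swap
  · exact hβ
  set e : Fin (Fintype.card (Fin n)) ≃ Fin n := Fintype.equivOfCardEq (Fintype.card_fin _) with he
  have hc0 : 0 < Fintype.card (Fin n) := by simp; omega
  have hc1 : 1 < Fintype.card (Fin n) := by simpa using hn
  have hne : e ⟨0, hc0⟩ ≠ e ⟨1, hc1⟩ := by simp
  set b := hA.eigenvectorBasis with hb
  have hev0 : hA.eigenvalues (e ⟨0, hc0⟩) = hA.eigenvalues₀ ⟨0, hc0⟩ := by
    simp [Matrix.IsHermitian.eigenvalues, he]
  have hev1 : hA.eigenvalues (e ⟨1, hc1⟩) = hA.eigenvalues₀ ⟨1, hc1⟩ := by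
    simp [Matrix.IsHermitian.eigenvalues, he]
  have hmono : hA.eigenvalues₀ ⟨1, hc1⟩ ≤ hA.eigenvalues₀ ⟨0, hc0⟩ :=
    hA.eigenvalues₀_antitone (by simp)
  obtain ⟨x, hx⟩ : ∃ x : Fin n → ℝ, x = b (e ⟨0, hc0⟩) := ⟨_, rfl⟩
  obtain ⟨y, hy⟩ : ∃ y : Fin n → ℝ, y = b (e ⟨1, hc1⟩) := ⟨_, rfl⟩
  have hAx : A.mulVec x = hA.eigenvalues₀ ⟨0, hc0⟩ • x := by
    rw [hx, hb, hA.mulVec_eigenvectorBasis, hev0]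
  have hAy : A.mulVec y = hA.eigenvalues₀ ⟨1, hc1⟩ • y := by
    rw [hy, hb, hA.mulVec_eigenvectorBasis, hev1]
  have hinner : ∀ k l, (b k : Fin n → ℝ) ⬝ᵥ (b l : Fin n → ℝ) = inner ℝ (b k) (b l) := fun k l => by
    simp [PiLp.inner_apply, dotProduct, mul_comm]
  have hxx : x ⬝ᵥ x = 1 := by rw [hx, hinner]; simp
  have hyy : y ⬝ᵥ y = 1 := by rw [hy, hinner]; simp
  have hxy : x ⬝ᵥ y = 0 := by rw [hx, hy, hinner]; exact b.orthonormal.2 hne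
  have hyx : y ⬝ᵥ x = 0 := by rw [dotProduct_comm, hxy]
  set m0 := hA.eigenvalues₀ ⟨0, hc0⟩
  set m1 := hA.eigenvalues₀ ⟨1, hc1⟩
  have hcomb : ∀ r s : ℝ, r * ∑ i, x i + s * ∑ i, y i = 0 →
      m0 * r ^ 2 + m1 * s ^ 2 ≤ β * (r ^ 2 + s ^ 2) := by
    intro r s hrs
    have := h (r • x + s • y) (by
      simpa [Finset.sum_add_distrib, ← Finset.mul_sum] using hrs)
    rw [Matrix.mulVec_add, Matrix.mulVec_smul, Matrix.mulVec_smul, hAx, hAy] at this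
    simp only [add_dotProduct, dotProduct_add, smul_dotProduct, dotProduct_smul, hxx, hyy, hxy,
      hyx, smul_eq_mul] at this
    nlinarith
  rcases eq_or_ne (∑ i, y i) 0 with hy0 | hy0
  · have := hcomb 0 1 (by simp [hy0])
    simpa using this
  -- These coefficients make the combination of eigenvectors sum to zero.
  · have := hcomb (∑ i, y i) (-∑ i, x i) (by ring)
    have hpos : 0 < (∑ i, y i) ^ 2 := by positivity
    have h1 := mul_le_mul_of_nonneg_right hmono hpos.le
    have h2 : 0 ≤ (∑ i, x i) ^ 2 := sq_nonneg _
    have h3 : m1 * ((∑ i, y i) ^ 2 + (∑ i, x i) ^ 2) ≤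
        β * ((∑ i, y i) ^ 2 + (∑ i, x i) ^ 2) := by
      rw [neg_sq] at this
      linarith
    exact le_of_mul_le_mul_right h3 (by linarith)

theorem sqGram_eq_kernelMatrix_add {d n : ℕ} (u : Fin n → UnitSphere d) :
    sqGram (fun i => (u i : EuclideanSpace ℝ (Fin d))) = kernelMatrix u + (1 - 1 / d : ℝ) • 1 +
      (1 / d : ℝ) • Matrix.vecMulVec (fun _ => 1) (fun _ => 1) := by
  ext i j
  rcases eq_or_ne i j with rfl | h
  · simp [sqGram, kernelMatrix, Matrix.vecMulVec_apply]
  · simp [sqGram, kernelMatrix, Matrix.vecMulVec_apply, centeredKernel, h]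

theorem kernelMatrix_transpose {d n : ℕ} (u : Fin n → UnitSphere d) :
    (kernelMatrix u).transpose = kernelMatrix u := by
  ext i j
  simp [kernelMatrix, centeredKernel_comm (u j), eq_comm]

theorem secondEigenvalue_sqGram_le {d n : ℕ} (u : Fin n → UnitSphere d) {q : ℝ} (hq : 0 ≤ q)
    (h : ∑ i, ∑ j, squareDeviation u i j ^ 2 ≤ q ^ 4) :
    secondEigenvalue (sqGram_isHermitian fun i => (u i : EuclideanSpace ℝ (Fin d))) ≤
      1 + n * kernelEigenvalue d + q := by
  have hα := kernelEigenvalue_nonneg d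
  refine secondEigenvalue_le _ (by positivity) fun a ha => ?_
  -- The coefficient `n - 2` is relaxed to `n`, since the upper bound must be nonnegative also for
  -- `n = 1`.
  have hK := dotProduct_mulVec_le_of_sq_near_smul (kernelMatrix_transpose u)
    (b := n * kernelEigenvalue d) (by nlinarith) (by positivity) hq h a
  have haa : 0 ≤ a ⬝ᵥ a := Finset.sum_nonneg fun i _ => mul_self_nonneg (a i)
  have hJ : (fun _ => 1 : Fin n → ℝ) ⬝ᵥ a = 0 := by simpa [dotProduct] using ha
  have hd0 : (0 : ℝ) ≤ 1 / d := by positivity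
  rw [sqGram_eq_kernelMatrix_add, Matrix.add_mulVec, Matrix.add_mulVec, dotProduct_add,
    dotProduct_add, Matrix.smul_mulVec, Matrix.smul_mulVec, Matrix.vecMulVec_mulVec, hJ,
    Matrix.one_mulVec, dotProduct_smul]
  simp only [MulOpposite.op_zero, zero_smul, smul_zero, dotProduct_zero, smul_eq_mul]
  nlinarith

/-! ### Probability of the spectral gap. -/

theorem randomUnitVectors_sum_squareDeviation_tail {d n : ℕ} (hd : 1 ≤ d) (hn : 1 ≤ n) :
    (randomUnitVectors d n).real {u | 200 * (n ^ 2 * kernelEigenvalue d +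
      2 * n ^ 3 * kernelEigenvalue d ^ 2) ≤ ∑ i, ∑ j, squareDeviation u i j ^ 2} ≤ 1 / 200 := by
  have := randomUnitVectors_isProbabilityMeasure hd n
  have hα : 0 < kernelEigenvalue d := by unfold kernelEigenvalue; positivity
  have hmk := mul_meas_ge_le_integral_of_nonneg (μ := randomUnitVectors d n)
    (f := fun u => ∑ i, ∑ j, squareDeviation u i j ^ 2)
    (Eventually.of_forall fun u => Finset.sum_nonneg fun i _ => Finset.sum_nonneg fun j _ =>
      sq_nonneg _)
    (integrable_of_continuous _ (continuous_finsetSum _ fun i _ => continuous_finsetSum _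
      fun j _ => (continuous_squareDeviation_apply i j).fun_pow 2))
    (200 * (n ^ 2 * kernelEigenvalue d + 2 * n ^ 3 * kernelEigenvalue d ^ 2))
  have hE : 0 < n ^ 2 * kernelEigenvalue d + 2 * n ^ 3 * kernelEigenvalue d ^ 2 := by positivity
  have h1 := hmk.trans (integral_sum_squareDeviation_sq_le hd)
  set p := (randomUnitVectors d n).real {u | 200 * (n ^ 2 * kernelEigenvalue d +
    2 * n ^ 3 * kernelEigenvalue d ^ 2) ≤ ∑ i, ∑ j, squareDeviation u i j ^ 2}
  have h2 : (n ^ 2 * kernelEigenvalue d + 2 * n ^ 3 * kernelEigenvalue d ^ 2) * (200 * p) ≤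
      (n ^ 2 * kernelEigenvalue d + 2 * n ^ 3 * kernelEigenvalue d ^ 2) * 1 := by linarith
  have := le_of_mul_le_mul_left h2 hE
  linarith

/-- In units of `n/d`, the three terms of `1 + nα + q` cost at most `η`, exactly `2 / (d + 2)`, and
`η` for the choice `q = η n / d`. A linear lower bound on `n` is enough. -/
theorem randomUnitVectors_not_hasFrameSpectralGap_le {d n : ℕ} (hd : 1 ≤ d) {lam η C : ℝ}
    (hη : 0 < η) (hη1 : η ≤ 1) (hC : 2000 / η ^ 4 ≤ C) (hn : C * d ≤ n)
    (hlam : 2 * η + 2 / (d + 2) ≤ (1 - lam) ^ 2) :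
    (randomUnitVectors d n).real {u | ¬ HasFrameSpectralGap lam
      (fun i => (u i : EuclideanSpace ℝ (Fin d)))} ≤ 1 / 200 := by
  have := randomUnitVectors_isProbabilityMeasure hd n
  have hd1 : (1 : ℝ) ≤ d := by exact_mod_cast hd
  have hη4 : 0 < η ^ 4 := by positivity
  have hη41 : η ^ 4 ≤ η := by
    calc η ^ 4 ≤ η ^ 1 := pow_le_pow_of_le_one hη.le hη1 (by norm_num)
      _ = η := pow_one η
  have hCη : 2000 ≤ C * η ^ 4 := (div_le_iff₀ hη4).1 hC
  have hC0 : 0 < C := lt_of_lt_of_le (by positivity) hC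
  have hCη' : 2000 ≤ C * η := hCη.trans (by gcongr)
  have hC1 : 2000 ≤ C := by nlinarith
  have hnC : C ≤ n := by nlinarith
  have hn0 : (0 : ℝ) < n := by linarith
  have hn1 : 1 ≤ n := by exact_mod_cast hn0
  have hnd : 1 ≤ η * (n / d) := by
    rw [← mul_div_assoc, le_div_iff₀ (by positivity)]
    nlinarith
  have hα : kernelEigenvalue d ≤ 2 / d ^ 2 := by
    unfold kernelEigenvalue
    gcongr
    nlinarith
  have hα0 := kernelEigenvalue_nonneg d
  have hbound : 200 * (n ^ 2 * kernelEigenvalue d + 2 * n ^ 3 * kernelEigenvalue d ^ 2) ≤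
      (η * (n / d)) ^ 4 := by
    calc _ ≤ 200 * (n ^ 2 * (2 / d ^ 2) + 2 * n ^ 3 * (2 / d ^ 2) ^ 2 : ℝ) := by gcongr
      _ = (n : ℝ) ^ 2 / d ^ 4 * (400 * (d : ℝ) ^ 2 + 1600 * n) := by
        field_simp
        ring
      -- Both `400 d²` and `1600 n` are absorbed in `2000 d n ≤ η⁴ n²`; this is the origin of the
      -- constant 2000.
      _ ≤ (n : ℝ) ^ 2 / d ^ 4 * (η ^ 4 * n ^ 2) := by
        gcongr
        have h1 : (d : ℝ) ^ 2 ≤ d * n := by nlinarith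
        have h2 : C * η ^ 4 * d ≤ n * η ^ 4 := by nlinarith
        have h3 : C * η ^ 4 ≤ n * η ^ 4 := by nlinarith
        nlinarith
      _ = _ := by
        field_simp
  refine le_trans (measureReal_mono fun u hu => ?_)
    (randomUnitVectors_sum_squareDeviation_tail hd hn1)
  by_contra hcon
  refine hu ?_
  have hlt : ∑ i, ∑ j, squareDeviation u i j ^ 2 ≤ (η * (n / d)) ^ 4 :=
    (not_le.1 hcon).le.trans hbound
  have h2 := secondEigenvalue_sqGram_le u (by positivity) hlt
  have hsize : frameSize (fun i => (u i : EuclideanSpace ℝ (Fin d))) = n := by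
    simp [frameSize]
  rw [HasFrameSpectralGap, hsize]
  refine h2.trans ?_
  have h3 : (n : ℝ) * kernelEigenvalue d = 2 / (d + 2) * (n / d) := by
    unfold kernelEigenvalue
    field_simp
  have h4 : (n : ℝ) ^ 2 / (d * n) = n / d := by
    field_simp
  rw [h3, h4]
  calc 1 + 2 / (d + 2) * (n / d : ℝ) + η * (n / d) ≤ (2 * η + 2 / (d + 2)) * (n / d : ℝ) := by
        linarith
    _ ≤ _ := by gcongr

/-! ### Union bound and choice of parameters. -/

theorem randomUnitVectors_goodFrames_ge {d n : ℕ} (hd : 1 ≤ d) {x lam η C : ℝ}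
    (hx0 : 0 ≤ x) (hx1 : x ≤ 1) (hx : 80 * d ≤ n * x ^ 2)
    (hη : 0 < η) (hη1 : η ≤ 1) (hC : 2000 / η ^ 4 ≤ C)
    (hn : C * (d : ℝ) ^ ((4 : ℝ) / 3) ≤ n) (hlam : 2 * η + 2 / (d + 2) ≤ (1 - lam) ^ 2) :
    (0.99 : ℝ) ≤ (randomUnitVectors d n).real (goodFrames d n (2 * x) lam) := by
  have := randomUnitVectors_isProbabilityMeasure hd n
  have hd1 : (1 : ℝ) ≤ d := by exact_mod_cast hd
  have hC0 : 0 < C := lt_of_lt_of_le (by positivity) hC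
  have hdn : C * d ≤ n := by
    refine le_trans ?_ hn
    gcongr
    calc (d : ℝ) = (d : ℝ) ^ (1 : ℝ) := (Real.rpow_one _).symm
      _ ≤ _ := Real.rpow_le_rpow_of_exponent_le hd1 (by norm_num)
  have h1 := randomUnitVectors_not_nearlyDoublyBalanced_le hd hx0 hx1 hx
  have h2 := randomUnitVectors_not_hasFrameSpectralGap_le hd hη hη1 hC hdn hlam
  -- Covering the whole space and using subadditivity bounds the good event from below without
  -- proving it measurable.
  have hcover : (Set.univ : Set (Fin n → UnitSphere d)) ⊆ goodFrames d n (2 * x) lam ∪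
      ({u | ¬ NearlyDoublyBalanced (2 * x) (fun i => (u i : EuclideanSpace ℝ (Fin d)))} ∪
      {u | ¬ HasFrameSpectralGap lam (fun i => (u i : EuclideanSpace ℝ (Fin d)))}) := by
    intro u _
    by_cases ha : NearlyDoublyBalanced (2 * x) (fun i => (u i : EuclideanSpace ℝ (Fin d)))
    · by_cases hb : HasFrameSpectralGap lam (fun i => (u i : EuclideanSpace ℝ (Fin d)))
      · exact Or.inl ⟨ha, hb⟩
      · exact Or.inr (Or.inr hb)
    · exact Or.inr (Or.inl ha)
  have h3 := measureReal_mono (μ := randomUnitVectors d n) hcover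
  rw [probReal_univ] at h3
  have h4 := h3.trans ((measureReal_union_le _ _).trans
    (add_le_add le_rfl (measureReal_union_le _ _)))
  norm_num at h1 h2 ⊢
  linarith

/-- The source of the exponent 4/3: at scale `x = a d^(-1/6)`, the quantity `n x²` is of order
`d^(4/3 - 1/3) = d`, as the concentration bound requires. -/
theorem mul_rpow_neg_sixth_sq {d : ℝ} (hd : 1 ≤ d) (a : ℝ) {C n : ℝ}
    (hn : C * d ^ ((4 : ℝ) / 3) ≤ n) : C * a ^ 2 * d ≤ n * (a * d ^ (-(1 / 6) : ℝ)) ^ 2 := by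
  have hd0 : 0 < d := by linarith
  calc C * a ^ 2 * d = C * d ^ ((4 : ℝ) / 3) * (a * d ^ (-(1 / 6) : ℝ)) ^ 2 := by
        have : d ^ ((4 : ℝ) / 3) * (d ^ (-(1 / 6) : ℝ)) ^ 2 = d := by
          rw [← Real.rpow_natCast, ← Real.rpow_mul hd0.le, ← Real.rpow_add hd0]
          norm_num
        rw [mul_pow]
        linear_combination -(C * a ^ 2) * this
    _ ≤ _ := by gcongr

theorem theoremt :
    (∃ ε : ℕ → ℝ, (∀ d, 0 ≤ ε d) ∧
      Tendsto (fun d : ℕ => ε d * Real.log (d : ℝ)) atTop (𝓝 0) ∧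
      ∀ lam : ℝ, 0 ≤ lam → lam < 1 →
        ∃ C : ℝ, 0 < C ∧ ∃ D : ℕ, ∀ d : ℕ, D ≤ d → ∀ n : ℕ,
          C * (d : ℝ) ^ ((4 : ℝ) / 3) ≤ (n : ℝ) →
            (0.99 : ℝ) ≤ (randomUnitVectors d n).real (goodFrames d n (ε d) lam)) ∧
    (∃ lam : ℝ, 0 < lam ∧ lam < 1 ∧ ∀ c : ℝ, 0 < c →
      ∃ C : ℝ, 0 < C ∧ ∀ d : ℕ, 1 ≤ d → ∀ n : ℕ,
        C * (d : ℝ) ^ ((4 : ℝ) / 3) ≤ (n : ℝ) →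
          ∃ ε : ℝ, 0 ≤ ε ∧ ε * Real.log (d : ℝ) ≤ c ∧
            (0.99 : ℝ) ≤ (randomUnitVectors d n).real (goodFrames d n ε lam)) := by
  constructor
  · have hlim0 : Tendsto (fun d : ℕ => √80 * (d : ℝ) ^ (-(1 / 6) : ℝ)) atTop (𝓝 0) := by
      simpa using ((tendsto_rpow_neg_atTop (by norm_num : (0 : ℝ) < 1 / 6)).comp
        tendsto_natCast_atTop_atTop).const_mul (√80)
    -- The factor `√80` meets `80 * d ≤ n * x ^ 2` with constant 1 in place of `C`, so the sequence
    -- does not depend on `lam`.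
    refine ⟨fun d => 2 * (√80 * (d : ℝ) ^ (-(1 / 6) : ℝ)), fun d => by positivity, ?_, ?_⟩
    · have h := ((isLittleO_log_rpow_atTop (by norm_num : (0 : ℝ) < 1 / 6)).tendsto_div_nhds_zero.comp
        tendsto_natCast_atTop_atTop).const_mul (2 * √80)
      rw [mul_zero] at h
      refine h.congr fun d => ?_
      simp only [Function.comp_apply]
      rw [Real.rpow_neg (Nat.cast_nonneg d), div_eq_mul_inv]
      ring
    · intro lam _ hlam
      have hρ : 0 < (1 - lam) ^ 2 := pow_pos (by linarith) 2
      have hρ1 : (1 - lam) ^ 2 ≤ 1 := by nlinarith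
      set ρ := (1 - lam) ^ 2
      obtain ⟨D₁, hD₁⟩ := eventually_atTop.1 (hlim0.eventually_le_const one_pos)
      -- For `d ≥ 4/ρ` the term `2 / (d + 2)` is at most `ρ / 2`; the choice `η = ρ / 4` takes the
      -- other half.
      obtain ⟨D₂, hD₂⟩ := exists_nat_ge (4 / ρ)
      have hC0 : 0 < 2000 / (ρ / 4) ^ 4 := by positivity
      refine ⟨2000 / (ρ / 4) ^ 4, hC0, max 1 (max D₁ D₂), fun d hd n hn => ?_⟩
      have hd1 : 1 ≤ d := (le_max_left _ _).trans hd
      have hdD₁ : D₁ ≤ d := ((le_max_left _ _).trans (le_max_right _ _)).trans hd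
      have hdD₂ : D₂ ≤ d := ((le_max_right _ _).trans (le_max_right _ _)).trans hd
      have hdr : (1 : ℝ) ≤ d := by exact_mod_cast hd1
      refine randomUnitVectors_goodFrames_ge hd1 (η := ρ / 4) (by positivity) (hD₁ d hdD₁) ?_
        (by positivity) (by linarith) le_rfl hn ?_
      · have h1 : (1 : ℝ) ≤ 2000 / (ρ / 4) ^ 4 := by
          rw [le_div_iff₀ (by positivity)]
          have : (ρ / 4) ^ 4 ≤ 1 := pow_le_one₀ (by positivity) (by linarith)
          linarith
        have := mul_rpow_neg_sixth_sq hdr (√80) (C := 1)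
          ((mul_le_mul_of_nonneg_right h1 (by positivity)).trans hn)
        rwa [Real.sq_sqrt (by norm_num), one_mul] at this
      · have h2 : 4 / ρ ≤ d := hD₂.trans (by exact_mod_cast hdD₂)
        have h3 : 4 ≤ d * ρ := (div_le_iff₀ hρ).1 h2
        have h4 : 2 / (d + 2 : ℝ) ≤ ρ / 2 := by
          rw [div_le_iff₀ (by positivity)]
          nlinarith
        linarith
  -- With `η = 1/20` the worst case `d = 1` reads `1/10 + 2/3 ≤ (9/10)²`, so no lower threshold on
  -- `d` is needed.
  · refine ⟨1 / 10, by norm_num, by norm_num, fun c hc => ?_⟩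
    -- Since `log d ≤ 6 d^(1/6)`, the product `ε log d` is at most `12 √(80 / C)`; the second entry
    -- of the maximum makes this at most `c`.
    set C : ℝ := max (2000 / (1 / 20) ^ 4) (80 * 144 / c ^ 2)
    have hC1 : 2000 / (1 / 20) ^ 4 ≤ C := le_max_left _ _
    have hC2 : 80 * 144 / c ^ 2 ≤ C := le_max_right _ _
    have hC80 : 80 ≤ C := le_trans (by norm_num) hC1
    have hC0 : 0 < C := by linarith
    refine ⟨C, hC0, fun d hd n hn => ?_⟩
    have hdr : (1 : ℝ) ≤ d := by exact_mod_cast hd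
    have hd0 : (0 : ℝ) < d := by linarith
    refine ⟨2 * (√(80 / C) * (d : ℝ) ^ (-(1 / 6) : ℝ)), by positivity, ?_, ?_⟩
    · have hlog := Real.log_le_rpow_div hd0.le (by norm_num : (0 : ℝ) < 1 / 6)
      have hsq : 12 * √(80 / C) ≤ c := by
        refine le_of_sq_le_sq ?_ hc.le
        rw [mul_pow, Real.sq_sqrt (by positivity), ← mul_div_assoc, div_le_iff₀ hC0]
        rw [div_le_iff₀ (by positivity)] at hC2
        linarith
      calc _ ≤ 2 * (√(80 / C) * (d : ℝ) ^ (-(1 / 6) : ℝ)) * ((d : ℝ) ^ (1 / 6 : ℝ) / (1 / 6)) := by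
            gcongr
        _ = 12 * √(80 / C) * ((d : ℝ) ^ (-(1 / 6) : ℝ) * (d : ℝ) ^ (1 / 6 : ℝ)) := by ring
        _ = 12 * √(80 / C) := by
            rw [← Real.rpow_add hd0]
            norm_num
        _ ≤ c := hsq
    · refine randomUnitVectors_goodFrames_ge hd (η := 1 / 20) (by positivity) ?_ ?_
        (by norm_num) (by norm_num) hC1 hn ?_
      · refine mul_le_one₀ (Real.sqrt_le_one.2 ((div_le_one hC0).2 hC80)) (by positivity)
          (Real.rpow_le_one_of_one_le_of_nonpos hdr (by norm_num))
      · have := mul_rpow_neg_sixth_sq hdr (√(80 / C)) hn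
        rwa [Real.sq_sqrt (by positivity), mul_div_cancel₀ _ hC0.ne'] at this
      · have : 2 / (d + 2 : ℝ) ≤ 2 / (1 + 2) := by gcongr
        norm_num at this ⊢
        linarith
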